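/- Let $q\ge 9$ be an odd prime power and let $V$ be a vector space over $\mathbb F_q$ of finite dimension $n+1\ge 5$ with a nondegenerate symmetric bilinear form $f$. Conventions. Let $U\neq 0$ be a subspace of $V$ (possibly $U=V$) on which $f$ is nondegenerate, of dimension $d$, let $\Delta$ be the Gram determinant of $f|_U$ in some basis, and put $e=\lfloor d/2\rfloor$. If $q\equiv 1 \pmod 4$ or $d$ is even, $U$ is positive if $(-1)^e\Delta$ is a square in $\mathbb F_q$; if $q\equiv 3\pmod 4$ and $d$ is odd, $U$ is positive if $(-1)^e\Delta$ is a non-square. Otherwise $U$ is negative. (In dimension $2e$, positive means Witt index $e$ and negative means Witt index $e-1$.) Let $X$ be the set of nonzero proper subspaces of $V$ on which $f$ is nondegenerate. Two elements of $X$ are incident if one contains the other, and the type of an element is its dimension; points, lines and planes are the elements of type $1,2,3$. A flag is a set of pairwise incident elements. A pregeometry (a set of elements with a reflexive symmetric incidence relation and a type function, incident elements of equal type being equal) is a geometry if every flag is contained in a flag in which all occurring types are represented. A cycle based at $x$ is a sequence $(x_0,\dots,x_k)$ of elements with $x_0=x_k=x$ and $x_i$ incident with $x_{i+1}$ for all $i<k$;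 it is null-homotopic if it can be transformed into $(x)$ by finitely many insertions and deletions of cycles of length $1$, $2$ or $3$ at an element of the sequence. A geometry is simply connected if it is connected (its incidence graph is nonempty and connected) and all its cycles are null-homotopic. Theorem. Suppose that $f$ is negative on $V$. Let $$W=\{p,p',l,\pi,U,U_1,\dots,U_t\}\subseteq X,\qquad t\ge 0,$$ where $p$ is a positive point, $p'$ is a negative point, $l$ is a negative line, $\pi$ is a (positive or negative) plane, $U$ is a positive four-dimensional subspace, and the $U_i$ are arbitrary elements of $X$ of dimension at least three. Assume that any two members of $W$ of different dimensions are incident. Let $$Y=\{x\in X \mid x\in g(W)\text{ for some } g\in \mathrm{SO}_{n+1}(\mathbb F_q,f)\}.$$ Then the pregeometry $(\mathcal G_A^{\rm orth})^W$ on $Y$ with the induced incidence and types is a geometry, and it is simply connected. -/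

import Mathlib

namespace OrthGeom

/-! ### Pregeometries and geometries -/

/-- A pregeometry with element set `X`: a symmetric and reflexive incidence relation and a type
function such that incident elements of the same type coincide. The type set of the pregeometry
is the range of `typ`, so that the type function is onto the type set by convention. -/
structure Pregeometry (X I : Type*) where
  inc : X → X → Prop
  typ : X → I
  inc_refl : ∀ x, inc x x
  inc_symm : ∀ x y, inc x y → inc y x
  eq_of_inc : ∀ x y, inc x y → typ x = typ y → x = y

namespace Pregeometry

variable {X I : Type*}

/-- A flag is a set of pairwise incident elements. -/
def IsFlag (G : Pregeometry X I) (F : Set X) : Prop :=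
  ∀ x ∈ F, ∀ y ∈ F, G.inc x y

/-- A chamber is a flag in which every type of the type set occurs. -/
def IsChamber (G : Pregeometry X I) (C : Set X) : Prop :=
  G.IsFlag C ∧ G.typ '' C = Set.range G.typ

/-- A geometry is a pregeometry in which every flag is contained in a chamber. -/
def IsGeometry (G : Pregeometry X I) : Prop :=
  ∀ F : Set X, G.IsFlag F → ∃ C : Set X, F ⊆ C ∧ G.IsChamber C

/-- A lounge is a set of elements each of whose subsets on which the type function is injective
is a flag. (A hall is a lounge in which all types of the type set occur.) -/
def IsLounge (G : Pregeometry X I) (W : Set X) : Prop :=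
  ∀ S : Set X, S ⊆ W → Set.InjOn G.typ S → G.IsFlag S

/-- The pregeometry induced on a subset `Y` of the elements. -/
def restrict (G : Pregeometry X I) (Y : Set X) : Pregeometry Y I where
  inc x y := G.inc x y
  typ x := G.typ x
  inc_refl x := G.inc_refl x
  inc_symm x y h := G.inc_symm x y h
  eq_of_inc x y h ht := Subtype.ext (G.eq_of_inc x y h ht)

/-- The incidence graph is connected (in particular nonempty). -/
def IsConnected (G : Pregeometry X I) : Prop :=
  Nonempty X ∧ ∀ x y, Relation.ReflTransGen G.inc x y

/-- `c` is a cycle based at `x`: a sequence `(x₀, …, x_k)` of consecutively incident elements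
with `x₀ = x_k = x`. Its length is `k`, one less than the length of the list. -/
def IsCycleAt (G : Pregeometry X I) (x : X) (c : List X) : Prop :=
  c.IsChain G.inc ∧ c.head? = some x ∧ c.getLast? = some x

/-- `l'` arises from `l` by inserting, at some element `x` of `l`, a repetition, a return or a
triangle, that is, a cycle based at `x` of length 1, 2 or 3. -/
def ElementaryInsertion (G : Pregeometry X I) (l l' : List X) : Prop :=
  ∃ (l₁ l₂ : List X) (x : X) (c : List X),
    G.IsCycleAt x c ∧ (c.length = 2 ∨ c.length = 3 ∨ c.length = 4) ∧
      l = l₁ ++ [x] ++ l₂ ∧ l' = l₁ ++ c ++ l₂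

/-- Homotopical equivalence: finitely many insertions and deletions of repetitions, returns and
triangles. -/
def Homotopic (G : Pregeometry X I) : List X → List X → Prop :=
  Relation.EqvGen G.ElementaryInsertion

/-- The fundamental group based at `x` is trivial: every cycle based at `x` is homotopically
equivalent to the trivial cycle `(x)`. -/
def TrivialFundamentalGroupAt (G : Pregeometry X I) (x : X) : Prop :=
  ∀ c : List X, G.IsCycleAt x c → G.Homotopic c [x]

/-- A simply connected geometry: a connected geometry whose fundamental groups are trivial. -/
def IsSimplyConnectedGeometry (G : Pregeometry X I) : Prop :=
  G.IsGeometry ∧ G.IsConnected ∧ ∀ x, G.TrivialFundamentalGroupAt x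

end Pregeometry

/-! ### Orthogonal spaces over finite fields -/

section Orthogonal

variable {K : Type*} [Field K] {V : Type*} [AddCommGroup V] [Module K V]

/-- The discriminant (Gram determinant) of a bilinear form on a finite-dimensional space, with
respect to some basis. Only its class modulo nonzero squares is used below, and that class does
not depend on the basis. -/
noncomputable def discr [FiniteDimensional K V] (f : LinearMap.BilinForm K V) : K :=
  (LinearMap.BilinForm.toMatrix (Module.finBasis K V) f).det

/-- For a nondegenerate symmetric bilinear form `f` over a finite field of odd order `q` on a space
of dimension `d`, put `e = ⌊d/2⌋`. The form is positive (of plus type, hyperbolic) if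
`(-1) ^ e * discr f` is
* a square, in case `q ≡ 1 mod 4` or `d` is even;
* a nonsquare, in case `q ≡ 3 mod 4` and `d` is odd.
For `q ≡ 1 mod 4` the factor `(-1) ^ e` is a square and plays no role. In even dimension `2e`,
positive means Witt index `e`. -/
def IsPositiveForm [FiniteDimensional K V] (f : LinearMap.BilinForm K V) : Prop :=
  ((Nat.card K % 4 = 1 ∨ Even (Module.finrank K V)) ∧
      IsSquare ((-1) ^ (Module.finrank K V / 2) * discr f)) ∨
    ((Nat.card K % 4 = 3 ∧ Odd (Module.finrank K V)) ∧
      ¬ IsSquare ((-1) ^ (Module.finrank K V / 2) * discr f))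

/-- A nondegenerate symmetric bilinear form that is not positive is negative (of minus type,
elliptic). -/
def IsNegativeForm [FiniteDimensional K V] (f : LinearMap.BilinForm K V) : Prop :=
  ¬ IsPositiveForm f

/-- The nonzero proper subspaces of `V` on which `f` is nondegenerate. -/
def NondegSubspace (f : LinearMap.BilinForm K V) : Type _ :=
  {U : Submodule K V // U ≠ ⊥ ∧ U ≠ ⊤ ∧ (f.restrict U).Nondegenerate}

namespace NondegSubspace

variable {f : LinearMap.BilinForm K V}

/-- The vector space dimension. -/
noncomputable def dim (U : NondegSubspace f) : ℕ := Module.finrank K U.1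

/-- The restriction of `f` to the subspace is positive. -/
def IsPositive [FiniteDimensional K V] (U : NondegSubspace f) : Prop :=
  IsPositiveForm (f.restrict U.1)

/-- The restriction of `f` to the subspace is negative. -/
def IsNegative [FiniteDimensional K V] (U : NondegSubspace f) : Prop :=
  IsNegativeForm (f.restrict U.1)

end NondegSubspace

/-- The pregeometry of all nonzero proper nondegenerate subspaces of `V`, with symmetrized
containment as incidence and the dimension as type. -/
noncomputable def orthPregeometry [FiniteDimensional K V] (f : LinearMap.BilinForm K V) :
    Pregeometry (NondegSubspace f) ℕ where
  inc U U' := U.1 ≤ U'.1 ∨ U'.1 ≤ U.1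
  typ U := U.dim
  inc_refl _ := Or.inl le_rfl
  inc_symm _ _ h := h.symm
  eq_of_inc _ _ h ht := Subtype.ext <| h.elim
    (fun h => Submodule.eq_of_le_of_finrank_eq h ht)
    (fun h => (Submodule.eq_of_le_of_finrank_eq h ht.symm).symm)

/-- `g` lies in the special orthogonal group of `f`. -/
def IsSpecialOrthogonal (f : LinearMap.BilinForm K V) (g : V ≃ₗ[K] V) : Prop :=
  (∀ v w, f (g v) (g w) = f v w) ∧ LinearMap.det (g : V →ₗ[K] V) = 1

/-- The elements of the pregeometry that lie in `g(W)` for some special orthogonal `g`. -/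
def orbitSet (f : LinearMap.BilinForm K V) (W : Set (NondegSubspace f)) :
    Set (NondegSubspace f) :=
  {x | ∃ g : V ≃ₗ[K] V, IsSpecialOrthogonal f g ∧
    ∃ w ∈ W, x.1 = w.1.map (g : V →ₗ[K] V)}

/-- The pregeometry induced on the special orthogonal translates of the members of `W`. -/
noncomputable def orthPregeometryOf [FiniteDimensional K V] (f : LinearMap.BilinForm K V)
    (W : Set (NondegSubspace f)) : Pregeometry (orbitSet f W) ℕ :=
  (orthPregeometry f).restrict (orbitSet f W)

end Orthogonal

end OrthGeom

-- Cycles are never contracted by hand. Consider a function on incident pairs with values in a group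
-- that is multiplicative on triangles. If every such cocycle is a coboundary, then the cocycle of
-- the universal covering, which takes values in permutations of homotopy classes, is one too, and
-- this forces every cycle to be null-homotopic (`trivialFundamentalGroupAt_of_cocycle`).
--
-- The special orthogonal group is transitive on nondegenerate subspaces of given dimension and
-- discriminant (`exists_isSpecialOrthogonal_map_eq`). Hence the orbit of `W` contains all
-- anisotropic points, all elliptic lines and all hyperbolic four-dimensional subspaces; this is
-- `IsRich`, and the covering argument takes place in such a family. The geometry property comes
-- from the same transitivity: a gap in a flag leaves room to choose the norm of the last vector,
-- and so the discriminant, of a subspace filling it (`exists_between`).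
--
-- A cocycle has a holonomy between two anisotropic vectors of a common member. Along an elliptic
-- line it does not depend on the member, since the line itself is a member. Two members that share
-- an elliptic line define the same holonomy between any two common anisotropic vectors, because
-- each of these is joined by an elliptic line to some vector of the shared line. A nondegenerate
-- plane contains an elliptic line, so sharing a plane is enough. Any two members through a
-- nondegenerate line are then compared with one hyperbolic four-space, the hub of `exists_hub`.
-- This gives a connection on pairs of vectors spanning a nondegenerate line.
--
-- The connection is multiplicative on triangles (`exists_connection`): a triangle spanning a
-- nondegenerate three-space lies in a member, and one spanning a degenerate three-space is the sum
-- of three nondegenerate triangles with a new apex. Any four anisotropic vectors have a common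
-- neighbour (`exists_common_neighbour`), so the connection integrates to a potential on vectors,
-- which then extends to all members (`exists_coboundary`).

universe u

/-! ### Homotopy of paths and the cocycle criterion for trivial fundamental groups -/

namespace OrthGeom.Pregeometry

variable {X I : Type*} {G : Pregeometry X I}

namespace Homotopic

theorem refl (l : List X) : G.Homotopic l l := Relation.EqvGen.refl l

theorem symm {l l' : List X} (h : G.Homotopic l l') : G.Homotopic l' l := Relation.EqvGen.symm _ _ h

theorem trans {l l' l'' : List X} (h : G.Homotopic l l') (h' : G.Homotopic l' l'') :
    G.Homotopic l l'' := Relation.EqvGen.trans _ _ _ h h'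

theorem append (a b : List X) {l l' : List X} (h : G.Homotopic l l') :
    G.Homotopic (a ++ l ++ b) (a ++ l' ++ b) := by
  induction h with
  | rel l l' h =>
    obtain ⟨l₁, l₂, x, c, hc, hlen, rfl, rfl⟩ := h
    exact Relation.EqvGen.rel _ _ ⟨a ++ l₁, l₂ ++ b, x, c, hc, hlen, by simp, by simp⟩
  | refl l => exact refl _
  | symm l l' _ ih => exact ih.symm
  | trans l l' l'' _ _ ih ih' => exact ih.trans ih'

theorem append_left (a : List X) {l l' : List X} (h : G.Homotopic l l') :
    G.Homotopic (a ++ l) (a ++ l') := by simpa using h.append a []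

theorem append_right (b : List X) {l l' : List X} (h : G.Homotopic l l') :
    G.Homotopic (l ++ b) (l' ++ b) := by simpa using h.append [] b

theorem of_cycle {x : X} {c : List X} (hc : G.IsCycleAt x c)
    (h : c.length = 2 ∨ c.length = 3 ∨ c.length = 4) : G.Homotopic c [x] :=
  (Relation.EqvGen.rel _ _ ⟨[], [], x, c, hc, h, by simp, by simp⟩ : G.Homotopic [x] c).symm

theorem repetition (x : X) : G.Homotopic [x, x] [x] :=
  of_cycle ⟨by simp [G.inc_refl], by simp, by simp⟩ (by simp)

theorem return_ {x y : X} (h : G.inc x y) : G.Homotopic [x, y, x] [x] :=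
  of_cycle ⟨by simp [h, G.inc_symm _ _ h], by simp, by simp⟩ (by simp)

/-- Insert the return `z, x, z` at the end; this exposes the closed triangle at `x`, which is
deleted. -/
theorem triangle {x y z : X} (h : G.inc x y) (h' : G.inc y z) (h'' : G.inc x z) :
    G.Homotopic [x, y, z] [x, z] := by
  have h1 : G.Homotopic ([x, y, z, x] ++ [z]) ([x] ++ [z]) :=
    (of_cycle ⟨by simp [h, h', G.inc_symm _ _ h''], by simp, by simp⟩ (by simp)).append_right [z]
  have h2 : G.Homotopic ([x, y] ++ [z, x, z]) ([x, y] ++ [z]) :=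
    (return_ (G.inc_symm _ _ h'')).append_left [x, y]
  exact h2.symm.trans h1

theorem append_reverse (τ : List X) (h : τ.IsChain G.inc) (x : X) (hx : τ.head? = some x) :
    G.Homotopic (τ ++ τ.reverse) [x] := by
  induction τ generalizing x with
  | nil => simp at hx
  | cons a t ih =>
    obtain rfl : a = x := by simpa using hx
    cases t with
    | nil => simpa using repetition a
    | cons b t =>
      rw [List.isChain_cons_cons] at h
      have h1 := (ih h.2 b (by simp)).append [a] [a]
      simp only [List.cons_append, List.nil_append, List.append_assoc, List.reverse_cons] at h1 ⊢
      exact h1.trans (return_ h.1)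

theorem reverse_append (τ : List X) (h : τ.IsChain G.inc) (x : X) (hx : τ.getLast? = some x) :
    G.Homotopic (τ.reverse ++ τ) [x] := by
  have := append_reverse (G := G) τ.reverse
    (by rw [List.isChain_reverse]; exact h.imp fun a b hab => G.inc_symm _ _ hab) x (by simpa)
  simpa using this

end Homotopic

section Cocycle

variable {x₀ : X} (τ : X → List X)

/-- Lists are identified if they become homotopic after appending the base point. -/
def basedSetoid (G : Pregeometry X I) (x₀ : X) : Setoid (List X) where
  r c c' := G.Homotopic (c ++ [x₀]) (c' ++ [x₀])
  iseqv := ⟨fun _ => .refl _, .symm, .trans⟩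

/-- Appending the path `τ x` followed by the reverse of `τ y`. -/
def shift (G : Pregeometry X I) (hτ : ∀ x, (τ x).head? = some x₀) (x y : X) :
    Quotient (basedSetoid G x₀) → Quotient (basedSetoid G x₀) :=
  Quotient.map (fun c => c ++ (τ x ++ (τ y).reverse)) (by
    intro c c' h
    -- The appended path begins with `x₀`, which is the letter that the relation appends to both
    -- lists; this makes the map well defined.
    obtain ⟨t, ht⟩ : ∃ t, τ x = x₀ :: t := by
      have := hτ x
      cases hx : τ x with
      | nil => simp [hx] at this
      | cons a t => rw [hx] at this; simp at this; exact ⟨t, by rw [this]⟩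
    have := Homotopic.append_right (t ++ (τ y).reverse ++ [x₀]) (show G.Homotopic _ _ from h)
    show G.Homotopic _ _
    rw [ht]
    simpa using this)

theorem shift_mk (hτ : ∀ x, (τ x).head? = some x₀) (x y : X) (c : List X) :
    shift τ G hτ x y (Quotient.mk _ c) = Quotient.mk _ (c ++ (τ x ++ (τ y).reverse)) := rfl

variable (hτ : ∀ x, (τ x).head? = some x₀) (hc : ∀ x, (τ x).IsChain G.inc)
  (hl : ∀ x, (τ x).getLast? = some x)

include hc hl

/-- The middle part, `τ y` reversed followed by `τ y`, cancels to `y`, and the remaining detour `x,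
y, z` is a triangle. -/
theorem shift_comp {x y z : X} (hxy : G.inc x y) (hyz : G.inc y z) (hxz : G.inc x z)
    (c : Quotient (basedSetoid G x₀)) :
    shift τ G hτ y z (shift τ G hτ x y c) = shift τ G hτ x z c := by
  induction c using Quotient.inductionOn with
  | h c =>
  simp only [shift_mk]
  apply Quotient.sound
  show G.Homotopic _ _
  have split : ∀ x, ∃ t, τ x = t ++ [x] := fun x => by
    obtain ⟨t, ht⟩ := List.getLast?_eq_some_iff.1 (hl x)
    exact ⟨t, ht⟩
  obtain ⟨t, ht⟩ := split x
  obtain ⟨s, hs⟩ := split z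
  have h1 := (Homotopic.reverse_append (τ y) (hc y) y (hl y)).append
    (c ++ τ x) ((τ z).reverse ++ [x₀])
  have h2 := (Homotopic.triangle hxy hyz hxz).append (c ++ t) (s.reverse ++ [x₀])
  have h1' : G.Homotopic (c ++ (τ x ++ (τ y).reverse) ++ (τ y ++ (τ z).reverse) ++ [x₀])
      (c ++ τ x ++ [y] ++ ((τ z).reverse ++ [x₀])) := by
    simpa using h1
  refine h1'.trans ?_
  rw [ht, hs]
  simpa using h2

omit hl in
theorem shift_self (x : X) (c : Quotient (basedSetoid G x₀)) : shift τ G hτ x x c = c := by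
  induction c using Quotient.inductionOn with
  | h c =>
  rw [shift_mk]
  apply Quotient.sound
  show G.Homotopic _ _
  have h1 := (Homotopic.append_reverse (τ x) (hc x) x₀ (hτ x)).append c [x₀]
  have h2 := (Homotopic.repetition (G := G) x₀).append_left c
  simp only [List.append_assoc, List.cons_append, List.nil_append] at h1 h2 ⊢
  exact h1.trans h2

open Classical in
/-- The permutation-valued cocycle of the universal covering. -/
noncomputable def shiftPerm (x y : X) : Equiv.Perm (Quotient (basedSetoid G x₀)) :=
  if h : G.inc x y then
    -- The arguments are swapped because permutations compose from right to left while paths are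
    -- appended on the right.
    { toFun := shift τ G hτ y x
      invFun := shift τ G hτ x y
      left_inv := fun c => by
        rw [shift_comp τ hτ hc hl (G.inc_symm _ _ h) h (G.inc_refl _), shift_self τ hτ hc]
      right_inv := fun c => by
        rw [shift_comp τ hτ hc hl h (G.inc_symm _ _ h) (G.inc_refl _), shift_self τ hτ hc] }
  else 1

theorem shiftPerm_apply {x y : X} (h : G.inc x y) (c) :
    shiftPerm τ hτ hc hl x y c = shift τ G hτ y x c := by
  simp [shiftPerm, h]

end Cocycle

/-- A connected pregeometry all of whose group-valued cocycles are coboundaries has trivial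
fundamental groups. -/
theorem trivialFundamentalGroupAt_of_cocycle {X : Type u} {G : Pregeometry X I}
    (hconn : G.IsConnected)
    (hcob : ∀ (H : Type u) [Group H] (φ : X → X → H),
      (∀ x y z, G.inc x y → G.inc y z → G.inc x z → φ x y * φ y z = φ x z) →
      ∃ ψ : X → H, ∀ x y, G.inc x y → φ x y = (ψ x)⁻¹ * ψ y) (x₀ : X) :
    G.TrivialFundamentalGroupAt x₀ := by
  have hpath : ∀ x, ∃ l : List X, l.head? = some x₀ ∧ l.IsChain G.inc ∧ l.getLast? = some x := by
    intro x
    obtain ⟨l, h1, h2⟩ := List.exists_isChain_cons_of_relationReflTransGen (hconn.2 x₀ x)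
    refine ⟨x₀ :: l, by simp, h1, ?_⟩
    rw [List.getLast?_eq_some_getLast (by simp), h2]
  choose τ hτ hc hl using hpath
  obtain ⟨ψ, hψ⟩ := hcob (Equiv.Perm (Quotient (basedSetoid G x₀))) (shiftPerm τ hτ hc hl) (by
    intro x y z hxy hyz hxz
    ext c
    rw [Equiv.Perm.mul_apply, shiftPerm_apply τ hτ hc hl hyz, shiftPerm_apply τ hτ hc hl hxy,
      shiftPerm_apply τ hτ hc hl hxz]
    exact shift_comp τ hτ hc hl (G.inc_symm _ _ hyz) (G.inc_symm _ _ hxy) (G.inc_symm _ _ hxz) c)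
  -- The coboundary telescopes along a path, so the permutation depends only on the two ends
  -- although it appends the whole path.
  have key : ∀ (c : List X) (a b : X), c.IsChain G.inc → c.head? = some a → c.getLast? = some b →
      ∀ t : List X, ((ψ b)⁻¹ * ψ a) (Quotient.mk _ t) =
        Quotient.mk _ (t ++ (τ a ++ c ++ (τ b).reverse)) := by
    intro c
    induction c with
    | nil => intro a b _ h; simp at h
    | cons a' c ih =>
      intro a b hch ha hb t
      obtain rfl : a' = a := by simpa using ha
      obtain ⟨s, hs⟩ := List.getLast?_eq_some_iff.1 (hl a')
      cases c with
      | nil =>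
        obtain rfl : a' = b := by simpa using hb
        rw [inv_mul_cancel, Equiv.Perm.one_apply, ← shift_self τ hτ hc a' (Quotient.mk _ t),
          shift_mk]
        apply Quotient.sound
        show G.Homotopic _ _
        have := ((Homotopic.repetition (G := G) a').append (t ++ s) (a' :: (s.reverse ++ [x₀]))).symm
        rw [hs]
        simpa using this
      | cons d c =>
        rw [List.isChain_cons_cons] at hch
        have h1 := ih d b hch.2 (by simp) (by simpa using hb) (t ++ (τ a' ++ (τ d).reverse))
        have h2 : (ψ b)⁻¹ * ψ a' = ((ψ b)⁻¹ * ψ d) * shiftPerm τ hτ hc hl d a' := by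
          rw [hψ d a' (G.inc_symm _ _ hch.1)]; group
        rw [h2, Equiv.Perm.mul_apply, shiftPerm_apply τ hτ hc hl (G.inc_symm _ _ hch.1), shift_mk,
          h1]
        apply Quotient.sound
        show G.Homotopic _ _
        have h3 := (Homotopic.reverse_append (τ d) (hc d) d (hl d)).append
          (t ++ τ a') (d :: c ++ (τ b).reverse ++ [x₀])
        have h4 := (Homotopic.repetition (G := G) d).append (t ++ τ a') (c ++ (τ b).reverse ++ [x₀])
        have h5 := ((Homotopic.repetition (G := G) a').append (t ++ s)
          (d :: (c ++ (τ b).reverse ++ [x₀]))).symm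
        rw [hs] at h3 h4 ⊢
        simp only [List.append_assoc, List.cons_append, List.nil_append] at h3 h4 h5 ⊢
        exact h3.trans (h4.trans h5)
  rintro c ⟨hch, ha, hb⟩
  have h1 := key c x₀ x₀ hch ha hb []
  rw [inv_mul_cancel, Equiv.Perm.one_apply] at h1
  have h2 : G.Homotopic ([] ++ [x₀]) ([] ++ (τ x₀ ++ c ++ (τ x₀).reverse) ++ [x₀]) :=
    Quotient.exact h1
  -- The chosen path `τ x₀` is a cycle that need not be the trivial one, so the conjugation by it
  -- has to be undone.
  have h3 := (h2.append (τ x₀).reverse (τ x₀))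
  have e := Homotopic.reverse_append (τ x₀) (hc x₀) x₀ (hl x₀)
  have e' := Homotopic.append_reverse (τ x₀) (hc x₀) x₀ (hτ x₀)
  obtain ⟨t, ht⟩ : ∃ t, τ x₀ = x₀ :: t := by
    have := hτ x₀
    cases hx : τ x₀ with
    | nil => simp [hx] at this
    | cons a t => rw [hx] at this; simp at this; exact ⟨t, by rw [this]⟩
  obtain ⟨c₁, hc₁⟩ : ∃ t, c = x₀ :: t := by
    cases hx : c with
    | nil => simp [hx] at ha
    | cons a t => rw [hx] at ha; simp at ha; exact ⟨t, by rw [ha]⟩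
  obtain ⟨c₂, hc₂⟩ := List.getLast?_eq_some_iff.1 hb
  have r : G.Homotopic ((τ x₀).reverse ++ [x₀] ++ τ x₀) [x₀] := by
    refine Homotopic.trans ?_ e
    have := (Homotopic.repetition (G := G) x₀).append (τ x₀).reverse t
    rw [ht] at this ⊢
    simpa using this
  have a1 : G.Homotopic ([x₀] ++ c) c := by
    have := (Homotopic.repetition (G := G) x₀).append_right c₁
    rw [hc₁]
    simpa using this
  have a2 : G.Homotopic (c ++ [x₀]) c := by
    have := (Homotopic.repetition (G := G) x₀).append_left c₂
    rw [hc₂]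
    simpa using this
  have h4 : G.Homotopic
      ((τ x₀).reverse ++ ([] ++ (τ x₀ ++ c ++ (τ x₀).reverse) ++ [x₀]) ++ τ x₀) ([x₀] ++ c ++ [x₀]) := by
    have u1 := e.append_right (c ++ (τ x₀).reverse ++ [x₀] ++ τ x₀)
    have u2 := r.append_left ([x₀] ++ c)
    simp only [List.append_assoc, List.cons_append, List.nil_append] at u1 u2 ⊢
    exact u1.trans u2
  exact ((a1.append_right [x₀]).trans a2).symm.trans (h4.symm.trans (h3.symm.trans
    (by simpa using r)))

end OrthGeom.Pregeometry

/-! ### Squares and binary quadratic equations over finite fields of odd order -/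

namespace OrthGeom

section Scalars

variable {K : Type*} [Field K]

theorem isSquare_mul_sq_iff {a s : K} (hs : s ≠ 0) : IsSquare (a * s ^ 2) ↔ IsSquare a := by
  constructor
  · rintro ⟨r, hr⟩
    exact ⟨r / s, by field_simp; linear_combination hr⟩
  · rintro ⟨r, rfl⟩
    exact ⟨r * s, by ring⟩

variable [Finite K]

theorem two_ne_zero_of_odd_card (hodd : Odd (Nat.card K)) : (2 : K) ≠ 0 := by
  intro h
  have : Fintype K := Fintype.ofFinite K
  have h2 : ringChar K = 2 := by
    have := (ringChar.spec K 2).1 (by exact_mod_cast h)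
    rcases (Nat.dvd_prime Nat.prime_two).1 this with h1 | h1
    · exact absurd h1 CharP.ringChar_ne_one
    · exact h1
  have := FiniteField.even_card_iff_char_two.1 h2
  rw [Nat.card_eq_fintype_card, Nat.odd_iff] at hodd
  omega

theorem ringChar_ne_two_of_odd_card (hodd : Odd (Nat.card K)) : ringChar K ≠ 2 := by
  intro h
  have : Fintype K := Fintype.ofFinite K
  have := FiniteField.even_card_iff_char_two.1 h
  rw [Nat.card_eq_fintype_card, Nat.odd_iff] at hodd
  omega

theorem isSquare_mul_iff (hodd : Odd (Nat.card K)) {a b : K} (ha : a ≠ 0) (hb : b ≠ 0) :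
    IsSquare (a * b) ↔ (IsSquare a ↔ IsSquare b) := by
  classical
  have : Fintype K := Fintype.ofFinite K
  have hch := ringChar_ne_two_of_odd_card hodd
  rw [← quadraticChar_one_iff_isSquare (mul_ne_zero ha hb), ← quadraticChar_one_iff_isSquare ha,
    ← quadraticChar_one_iff_isSquare hb, map_mul]
  rcases quadraticChar_dichotomy ha with h | h <;> rcases quadraticChar_dichotomy hb with h' | h' <;>
    simp [h, h']

theorem exists_sq_add_mul_sq (hodd : Odd (Nat.card K)) {g : K} (hg : g ≠ 0) (c : K) :
    ∃ s b : K, s ^ 2 + g * b ^ 2 = c := by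
  have : Fintype K := Fintype.ofFinite K
  obtain ⟨s, b, h⟩ := FiniteField.exists_root_sum_quadratic (R := K)
    (f := Polynomial.X ^ 2 - Polynomial.C c) (g := Polynomial.C g * Polynomial.X ^ 2)
    (Polynomial.degree_X_pow_sub_C (by norm_num) c) (by
      rw [Polynomial.degree_C_mul_X_pow _ hg]; rfl)
    (by rw [Nat.card_eq_fintype_card, Nat.odd_iff] at hodd; exact hodd)
  refine ⟨s, b, ?_⟩
  simp at h
  linear_combination h

theorem exists_not_isSquare (hodd : Odd (Nat.card K)) : ∃ a : K, ¬ IsSquare a :=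
  FiniteField.exists_nonsquare (ringChar_ne_two_of_odd_card hodd)

end Scalars

/-! ### Orthogonal families and discriminants -/

section Bilinear

variable {K : Type*} [Field K] {V : Type*} [AddCommGroup V] [Module K V]

/-- The Gram determinant of a pair of vectors. -/
def gram (f : LinearMap.BilinForm K V) (x y : V) : K := f x x * f y y - f x y ^ 2

/-- The form is nondegenerate on the subspace `A`. -/
def IsNondegOn (f : LinearMap.BilinForm K V) (A : Submodule K V) : Prop :=
  ∀ x ∈ A, (∀ y ∈ A, f x y = 0) → x = 0

/-- The first `k` members of `v` are pairwise orthogonal and anisotropic. -/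
structure IsOrthFamily (f : LinearMap.BilinForm K V) (v : ℕ → V) (k : ℕ) : Prop where
  ne : ∀ i < k, f (v i) (v i) ≠ 0
  orth : ∀ i < k, ∀ j < k, i ≠ j → f (v i) (v j) = 0

/-- The span of the first `k` members of `v`. -/
def spanLT (K : Type*) [Field K] {V : Type*} [AddCommGroup V] [Module K V] (v : ℕ → V) (k : ℕ) :
    Submodule K V := Submodule.span K (v '' Set.Iio k)

theorem mem_spanLT {v : ℕ → V} {k i : ℕ} (h : i < k) : v i ∈ spanLT K v k :=
  Submodule.subset_span ⟨i, h, rfl⟩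

theorem spanLT_le {v : ℕ → V} {k : ℕ} {A : Submodule K V} : spanLT K v k ≤ A ↔ ∀ i < k, v i ∈ A := by
  rw [spanLT, Submodule.span_le]
  exact ⟨fun h i hi => h ⟨i, hi, rfl⟩, by rintro h _ ⟨i, hi, rfl⟩; exact h i hi⟩

theorem spanLT_congr {v w : ℕ → V} {k : ℕ} (h : ∀ i < k, v i = w i) :
    spanLT K v k = spanLT K w k := by
  apply le_antisymm <;> rw [spanLT_le] <;> intro i hi
  · rw [h i hi]; exact mem_spanLT hi
  · rw [← h i hi]; exact mem_spanLT hi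

theorem spanLT_eq_range (v : ℕ → V) (k : ℕ) :
    spanLT K v k = Submodule.span K (Set.range fun i : Fin k => v i) := by
  apply le_antisymm
  · rw [spanLT_le]
    exact fun i hi => Submodule.subset_span ⟨⟨i, hi⟩, rfl⟩
  · rw [Submodule.span_le]
    rintro _ ⟨i, rfl⟩
    exact mem_spanLT i.2

variable {f : LinearMap.BilinForm K V}

theorem orth_spanLT {v : ℕ → V} {k : ℕ} {u : V} (h : ∀ i < k, f u (v i) = 0) :
    ∀ s ∈ spanLT K v k, f u s = 0 := by
  have : spanLT K v k ≤ LinearMap.ker (f u) := spanLT_le.2 fun i hi => h i hi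
  exact fun s hs => this hs

theorem isNondegOn_iff (hs : f.IsSymm) (A : Submodule K V) :
    IsNondegOn f A ↔ (f.restrict A).Nondegenerate := by
  constructor
  · intro h
    have h1 : ∀ x : A, (∀ y : A, f.restrict A x y = 0) → x = 0 := fun x hx =>
      Subtype.ext (h x x.2 fun y hy => hx ⟨y, hy⟩)
    refine ⟨h1, fun y hy => h1 y fun x => ?_⟩
    exact (hs.eq (y : V) x).trans (hy x)
  · intro h x hx hxy
    have := h.1 ⟨x, hx⟩ fun y => hxy y y.2
    simpa using this

namespace IsOrthFamily

theorem congr {v w : ℕ → V} {k : ℕ} (h : IsOrthFamily f v k) (hvw : ∀ i < k, w i = v i) :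
    IsOrthFamily f w k where
  ne i hi := by rw [hvw i hi]; exact h.ne i hi
  orth i hi j hj hij := by rw [hvw i hi, hvw j hj]; exact h.orth i hi j hj hij

theorem mono {v : ℕ → V} {k l : ℕ} (h : IsOrthFamily f v k) (hl : l ≤ k) : IsOrthFamily f v l where
  ne i hi := h.ne i (by omega)
  orth i hi j hj hij := h.orth i (by omega) j (by omega) hij

theorem update (hs : f.IsSymm) {v : ℕ → V} {k : ℕ} (h : IsOrthFamily f v k) {u : V}
    (hu : f u u ≠ 0) (huv : ∀ i < k, f u (v i) = 0) :
    IsOrthFamily f (Function.update v k u) (k + 1) where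
  ne i hi := by
    rcases eq_or_ne i k with rfl | hik
    · simpa using hu
    · rw [Function.update_of_ne hik]; exact h.ne i (by omega)
  orth i hi j hj hij := by
    rcases eq_or_ne i k with rfl | hik
    · rw [Function.update_self, Function.update_of_ne hij.symm]; exact huv j (by omega)
    · rcases eq_or_ne j k with rfl | hjk
      · rw [Function.update_self, Function.update_of_ne hij]
        exact (hs.eq _ _).symm.trans (huv i (by omega))
      · rw [Function.update_of_ne hik, Function.update_of_ne hjk]
        exact h.orth i (by omega) j (by omega) hij

variable {v : ℕ → V} {k : ℕ}

theorem linearIndependent (h : IsOrthFamily f v k) :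
    LinearIndependent K (fun i : Fin k => v i) := by
  rw [Fintype.linearIndependent_iff]
  intro g hg i
  have : f (v i) (∑ j, g j • v j) = g i * f (v i) (v i) := by
    rw [map_sum, Finset.sum_eq_single i]
    · simp
    · intro j _ hj
      simp [h.orth i i.2 j j.2 (fun e => hj (Fin.ext e.symm))]
    · simp
  rw [hg, map_zero] at this
  exact (mul_eq_zero.1 this.symm).resolve_right (h.ne i i.2)

theorem finrank_spanLT (h : IsOrthFamily f v k) : Module.finrank K (spanLT K v k) = k := by
  rw [spanLT_eq_range, finrank_span_eq_card h.linearIndependent, Fintype.card_fin]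

theorem isNondegOn_spanLT (h : IsOrthFamily f v k) : IsNondegOn f (spanLT K v k) := by
  intro x hx hxy
  rw [spanLT_eq_range] at hx
  obtain ⟨g, rfl⟩ := (Submodule.mem_span_range_iff_exists_fun K).1 hx
  refine Finset.sum_eq_zero fun i _ => ?_
  have h1 := hxy (v i) (mem_spanLT i.2)
  rw [map_sum, LinearMap.sum_apply, Finset.sum_eq_single i] at h1
  · have : g i = 0 := by simpa [h.ne i i.2] using h1
    rw [this, zero_smul]
  · intro j _ hj
    simp [h.orth j j.2 i i.2 (fun e => hj (Fin.ext e))]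
  · simp

/-- The Gram matrix in the basis `v` is diagonal, and passing to the basis used by `discr`
multiplies its determinant by the square of a change-of-basis determinant. -/
theorem discr_spanLT [FiniteDimensional K V] (h : IsOrthFamily f v k) :
    ∃ s : K, s ≠ 0 ∧ discr (f.restrict (spanLT K v k)) =
      (∏ i ∈ Finset.range k, f (v i) (v i)) * s ^ 2 := by
  have hA := spanLT_eq_range (K := K) v k
  have hfr := h.finrank_spanLT
  generalize spanLT K v k = A at hA hfr
  subst hA
  let b := Module.Basis.span h.linearIndependent
  let c := (Module.finBasis K (Submodule.span K (Set.range fun i : Fin k => v i))).reindex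
    (finCongr hfr)
  have hb : ∀ i, (b i : V) = v i := fun i => by
    simp [b, Module.Basis.span_apply]
  set F := f.restrict (Submodule.span K (Set.range fun i : Fin k => v i)) with hF
  have hdb : (LinearMap.BilinForm.toMatrix b F) = Matrix.diagonal fun i : Fin k => f (v i) (v i) := by
    ext i j
    rw [LinearMap.BilinForm.toMatrix_apply, hF, LinearMap.BilinForm.restrict_apply]
    simp only [LinearMap.domRestrict_apply]
    by_cases hij : i = j
    · subst hij; simp [hb]
    · rw [Matrix.diagonal_apply_ne _ hij]
      rw [hb, hb]
      exact h.orth i i.2 j j.2 fun e => hij (Fin.ext e)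
  have hdc : discr F = (LinearMap.BilinForm.toMatrix c F).det := by
    have : LinearMap.BilinForm.toMatrix c F = (LinearMap.BilinForm.toMatrix (Module.finBasis K _) F).submatrix
        (finCongr hfr).symm (finCongr hfr).symm := by
      ext i j
      simp [LinearMap.BilinForm.toMatrix_apply, c]
    rw [discr, this, Matrix.det_submatrix_equiv_self]
  have hbc := LinearMap.BilinForm.toMatrix_mul_basis_toMatrix b c F
  have hunit : IsUnit (b.toMatrix c).det := by
    have := congrArg Matrix.det (b.toMatrix_mul_toMatrix_flip c)
    rw [Matrix.det_mul, Matrix.det_one] at this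
    exact IsUnit.of_mul_eq_one _ this
  refine ⟨(b.toMatrix c).det, hunit.ne_zero, ?_⟩
  rw [hdc, ← hbc, Matrix.det_mul, Matrix.det_mul, Matrix.det_transpose, hdb, Matrix.det_diagonal,
    Finset.prod_range]
  ring

theorem prod_ne_zero (h : IsOrthFamily f v k) : ∏ i ∈ Finset.range k, f (v i) (v i) ≠ 0 :=
  Finset.prod_ne_zero_iff.2 fun i hi => h.ne i (Finset.mem_range.1 hi)

theorem discr_ne_zero [FiniteDimensional K V] (h : IsOrthFamily f v k) : discr (f.restrict (spanLT K v k)) ≠ 0 := by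
  obtain ⟨s, hs, e⟩ := h.discr_spanLT
  rw [e]
  exact mul_ne_zero h.prod_ne_zero (pow_ne_zero _ hs)

end IsOrthFamily

/-! ### Extension of orthogonal families with prescribed norms -/

section Extension

variable [FiniteDimensional K V]

/-- A nondegenerate proper subspace of a nondegenerate space has an anisotropic vector in its
orthogonal complement. -/
theorem exists_orth_anisotropic (h2 : (2 : K) ≠ 0) (hs : f.IsSymm) {A S : Submodule K V}
    (hA : IsNondegOn f A) (hS : IsNondegOn f S) (hSA : S ≤ A) (hne : ¬ A ≤ S) :
    ∃ u ∈ A, (∀ s ∈ S, f u s = 0) ∧ f u u ≠ 0 := by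
  by_contra hcon
  push Not at hcon
  obtain ⟨a, haA, haS⟩ := SetLike.not_le_iff_exists.1 hne
  have hcompl := LinearMap.BilinForm.isCompl_orthogonal_of_restrict_nondegenerate hs.isRefl
    ((isNondegOn_iff hs S).1 hS)
  have split : ∀ x : V, ∃ s ∈ S, ∃ t, (∀ s ∈ S, f t s = 0) ∧ s + t = x := by
    intro x
    have hx : x ∈ S ⊔ f.orthogonal S := by rw [hcompl.sup_eq_top]; trivial
    obtain ⟨s, hsS, t, ht, e⟩ := Submodule.mem_sup.1 hx
    refine ⟨s, hsS, t, fun r hr => ?_, e⟩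
    exact (hs.eq _ _).symm.trans (ht r hr)
  -- If all vectors of the complement of `S` in `A` were isotropic, polarization would make it
  -- totally isotropic, hence contained in the radical of `A`.
  have polar : ∀ t ∈ A, (∀ s ∈ S, f t s = 0) → ∀ t' ∈ A, (∀ s ∈ S, f t' s = 0) → f t t' = 0 := by
    intro t ht hts t' ht' hts'
    have e1 := hcon t ht hts
    have e2 := hcon t' ht' hts'
    have e3 := hcon (t + t') (A.add_mem ht ht') (fun s hsS => by
      rw [map_add, LinearMap.add_apply, hts s hsS, hts' s hsS, add_zero])
    simp only [map_add, LinearMap.add_apply, e1, e2, hs.eq t' t] at e3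
    have : 2 * f t t' = 0 := by linear_combination e3
    exact (mul_eq_zero.1 this).resolve_left h2
  obtain ⟨s, hsS, t, ht, e⟩ := split a
  have htA : t ∈ A := by
    have : t = a - s := by rw [← e]; abel
    rw [this]; exact A.sub_mem haA (hSA hsS)
  have : t = 0 := hA t htA fun y hy => by
    obtain ⟨s', hs', t', ht', e'⟩ := split y
    have htA' : t' ∈ A := by
      have : t' = y - s' := by rw [← e']; abel
      rw [this]; exact A.sub_mem hy (hSA hs')
    rw [← e', map_add, ht s' hs', polar t htA ht t' htA' ht', add_zero]
  rw [this, add_zero] at e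
  exact haS (e ▸ hsS)

-- Completing the square: `f x x` times the norm of `a • x + b • y` is `(f x x * a + f x y * b) ^ 2
-- + gram f x y * b ^ 2`, a binary form that takes every value.
omit [FiniteDimensional K V] in
theorem exists_smul_add_smul_eq [Finite K] (hodd : Odd (Nat.card K)) (hs : f.IsSymm) {x y : V}
    (hx : f x x ≠ 0) (hg : gram f x y ≠ 0) (c : K) :
    ∃ a b : K, f (a • x + b • y) (a • x + b • y) = c := by
  obtain ⟨s, b, h⟩ := exists_sq_add_mul_sq hodd hg (f x x * c)
  refine ⟨(s - f x y * b) / f x x, b, ?_⟩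
  have e : f y x = f x y := hs.eq y x
  simp only [map_add, LinearMap.add_apply, map_smul, LinearMap.smul_apply, smul_eq_mul, e]
  unfold gram at h
  apply mul_left_cancel₀ hx
  rw [← h]
  field_simp
  ring

theorem exists_orthFamily_update (h2 : (2 : K) ≠ 0) (hs : f.IsSymm) {A : Submodule K V}
    (hA : IsNondegOn f A) {v : ℕ → V} {k : ℕ} (hv : IsOrthFamily f v k) (hvA : spanLT K v k ≤ A)
    (hk : k < Module.finrank K A) : ∃ u ∈ A, (∀ i < k, f u (v i) = 0) ∧ f u u ≠ 0 := by
  obtain ⟨u, huA, huS, hu⟩ := exists_orth_anisotropic h2 hs hA hv.isNondegOn_spanLT hvA (by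
    intro hle
    have := Submodule.finrank_mono hle
    rw [hv.finrank_spanLT] at this
    omega)
  exact ⟨u, huA, fun i hi => huS _ (mem_spanLT hi), hu⟩

omit [FiniteDimensional K V] in
theorem spanLT_update_le {A : Submodule K V} {v : ℕ → V} {k : ℕ} (hvA : spanLT K v k ≤ A)
    {u : V} (hu : u ∈ A) : spanLT K (Function.update v k u) (k + 1) ≤ A := by
  rw [spanLT_le] at hvA ⊢
  intro i hi
  rcases eq_or_ne i k with rfl | hik
  · simpa using hu
  · rw [Function.update_of_ne hik]; exact hvA i (by omega)

/-- The complement of the family in `A` contains two orthogonal anisotropic vectors, and the plane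
they span represents every scalar. -/
theorem exists_orth_eq [Finite K] (hodd : Odd (Nat.card K)) (hs : f.IsSymm) {A : Submodule K V}
    (hA : IsNondegOn f A) {v : ℕ → V} {k : ℕ} (hv : IsOrthFamily f v k) (hvA : spanLT K v k ≤ A)
    (hk : k + 2 ≤ Module.finrank K A) (c : K) :
    ∃ u ∈ A, (∀ i < k, f u (v i) = 0) ∧ f u u = c := by
  have h2 := two_ne_zero_of_odd_card hodd
  obtain ⟨u, huA, huv, hu⟩ := exists_orthFamily_update h2 hs hA hv hvA (by omega)
  obtain ⟨u', huA', huv', hu'⟩ := exists_orthFamily_update h2 hs hA (hv.update hs hu huv)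
    (spanLT_update_le hvA huA) (by omega)
  have h0 : f u' u = 0 := by simpa using huv' k (by omega)
  have h1 : ∀ i < k, f u' (v i) = 0 := fun i hi => by
    have := huv' i (by omega)
    rwa [Function.update_of_ne (by omega)] at this
  obtain ⟨a, b, hab⟩ := exists_smul_add_smul_eq hodd hs hu (y := u') (by
    rw [gram, show f u u' = 0 from (hs.eq u' u).symm.trans h0]
    simp [hu, hu']) c
  exact ⟨_, A.add_mem (A.smul_mem a huA) (A.smul_mem b huA'), fun i hi => by
    simp [huv i hi, h1 i hi], hab⟩

/-- Partial orthogonal families in a nondegenerate space extend to orthogonal bases with prescribed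
values, as soon as the discriminants agree. -/
theorem exists_orthFamily_extend [Finite K] (hodd : Odd (Nat.card K)) (hs : f.IsSymm)
    {A : Submodule K V} (hA : IsNondegOn f A) (c : ℕ → K)
    (hc : ∀ i < Module.finrank K A, c i ≠ 0)
    (hd : IsSquare (discr (f.restrict A) * ∏ i ∈ Finset.range (Module.finrank K A), c i))
    {v : ℕ → V} {k : ℕ} (hv : IsOrthFamily f v k) (hvA : spanLT K v k ≤ A)
    (hvc : ∀ i < k, f (v i) (v i) = c i) (hk : k ≤ Module.finrank K A) :
    ∃ w : ℕ → V, (∀ i < k, w i = v i) ∧ IsOrthFamily f w (Module.finrank K A) ∧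
      spanLT K w (Module.finrank K A) = A ∧
      ∀ i < Module.finrank K A, f (w i) (w i) = c i := by
  obtain ⟨m, hm⟩ : ∃ m, Module.finrank K A = k + m := ⟨_, (Nat.add_sub_of_le hk).symm⟩
  induction m generalizing k v with
  | zero =>
    have hk' : Module.finrank K A = k := by simpa using hm
    refine ⟨v, fun _ _ => rfl, ?_⟩
    rw [hk']
    refine ⟨hv, Submodule.eq_of_le_of_finrank_eq hvA (by rw [hv.finrank_spanLT, hk']), hvc⟩
  | succ m ih =>
    suffices ∃ u ∈ A, (∀ i < k, f u (v i) = 0) ∧ f u u = c k by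
      obtain ⟨u, huA, huv, hu⟩ := this
      obtain ⟨w, hw, hw'⟩ := ih (v := Function.update v k u) (k := k + 1)
        (hv.update hs (by rw [hu]; exact hc k (by omega)) huv) (spanLT_update_le hvA huA) (by
          intro i hi
          rcases eq_or_ne i k with rfl | hik
          · simpa using hu
          · rw [Function.update_of_ne hik]; exact hvc i (by omega)) (by omega) (by omega)
      refine ⟨w, fun i hi => ?_, hw'⟩
      rw [hw i (by omega), Function.update_of_ne (by omega)]
    -- As long as two dimensions remain the norm can be prescribed freely. The last vector is
    -- determined up to a scalar, and only there is the discriminant condition needed.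
    cases m with
    | succ m => exact exists_orth_eq hodd hs hA hv hvA (by omega) _
    | zero =>
      have h2 := two_ne_zero_of_odd_card hodd
      obtain ⟨u, huA, huv, hu⟩ := exists_orthFamily_update h2 hs hA hv hvA (by omega)
      have hfam := hv.update hs hu huv
      have hle := spanLT_update_le hvA huA
      have hspan := Submodule.eq_of_le_of_finrank_eq hle (by rw [hfam.finrank_spanLT, hm])
      obtain ⟨s, hs0, hdis⟩ := hfam.discr_spanLT
      rw [hspan, Finset.prod_range_succ, Function.update_self, Finset.prod_congr rfl
        (g := c) (fun i hi => by
          rw [Finset.mem_range] at hi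
          rw [Function.update_of_ne (by omega), hvc i hi])] at hdis
      rw [hm, Nat.zero_add, Finset.prod_range_succ, hdis] at hd
      have hP : ∏ i ∈ Finset.range k, c i ≠ 0 :=
        Finset.prod_ne_zero_iff.2 fun i hi => hc i (by rw [Finset.mem_range] at hi; omega)
      have hck := hc k (by omega)
      obtain ⟨r, hr⟩ := hd
      set P := ∏ i ∈ Finset.range k, c i
      -- Here `r ^ 2` is the discriminant `P * f u u * s ^ 2` times `P * c k`; solving for the
      -- scalar that gives `u` the norm `c k` yields this factor.
      refine ⟨(r / (P * s * f u u)) • u, A.smul_mem _ huA, fun i hi => by simp [huv i hi], ?_⟩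
      simp only [map_smul, LinearMap.smul_apply, smul_eq_mul]
      field_simp
      linear_combination -hr

theorem exists_orthFamily_length (h2 : (2 : K) ≠ 0) (hs : f.IsSymm) {A : Submodule K V}
    (hA : IsNondegOn f A) {v : ℕ → V} {k : ℕ} (hv : IsOrthFamily f v k) (hvA : spanLT K v k ≤ A)
    {j : ℕ} (hkj : k ≤ j) (hj : j ≤ Module.finrank K A) :
    ∃ w : ℕ → V, (∀ i < k, w i = v i) ∧ IsOrthFamily f w j ∧ spanLT K w j ≤ A := by
  induction j, hkj using Nat.le_induction with
  | base => exact ⟨v, fun _ _ => rfl, hv, hvA⟩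
  | succ j hkj ih =>
    obtain ⟨w, hwv, hw, hwA⟩ := ih (by omega)
    obtain ⟨u, huA, huv, hu⟩ := exists_orthFamily_update h2 hs hA hw hwA (by omega)
    refine ⟨_, fun i hi => ?_, hw.update hs hu huv, spanLT_update_le hwA huA⟩
    rw [Function.update_of_ne (by omega), hwv i hi]

omit [FiniteDimensional K V] in
theorem isOrthFamily_zero (v : ℕ → V) : IsOrthFamily f v 0 := ⟨by simp, by simp⟩

omit [FiniteDimensional K V] in
theorem spanLT_zero_le (v : ℕ → V) (A : Submodule K V) : spanLT K v 0 ≤ A := spanLT_le.2 (by simp)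

theorem exists_orthFamily_of_isNondegOn (h2 : (2 : K) ≠ 0) (hs : f.IsSymm) {A : Submodule K V}
    (hA : IsNondegOn f A) :
    ∃ v : ℕ → V, IsOrthFamily f v (Module.finrank K A) ∧ spanLT K v (Module.finrank K A) = A := by
  obtain ⟨v, -, hv, hvA⟩ := exists_orthFamily_length h2 hs hA (isOrthFamily_zero fun _ => 0)
    (spanLT_zero_le _ A) (Nat.zero_le _) le_rfl
  exact ⟨v, hv, Submodule.eq_of_le_of_finrank_eq hvA hv.finrank_spanLT⟩

theorem discr_restrict_ne_zero (h2 : (2 : K) ≠ 0) (hs : f.IsSymm) {A : Submodule K V}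
    (hA : IsNondegOn f A) : discr (f.restrict A) ≠ 0 := by
  obtain ⟨v, hv, hvA⟩ := exists_orthFamily_of_isNondegOn h2 hs hA
  have := hv.discr_ne_zero
  rwa [hvA] at this

end Extension

end Bilinear

end OrthGeom

namespace OrthGeom

/-! ### Transitivity of the special orthogonal group -/

section Transitivity

variable {K : Type*} [Field K] {V : Type*} [AddCommGroup V] [Module K V] [FiniteDimensional K V]
  {f : LinearMap.BilinForm K V}

/-- The basis given by an orthogonal family of full length. -/
noncomputable def IsOrthFamily.basis {v : ℕ → V} (h : IsOrthFamily f v (Module.finrank K V)) :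
    Module.Basis (Fin (Module.finrank K V)) K V :=
  basisOfLinearIndependentOfCardEqFinrank' _ h.linearIndependent (by simp)

theorem IsOrthFamily.basis_apply {v : ℕ → V} (h : IsOrthFamily f v (Module.finrank K V))
    (i : Fin (Module.finrank K V)) : h.basis i = v i := by
  simp [IsOrthFamily.basis]

/-- Both orthogonal bases have the same Gram matrix, so the linear map between them is an isometry,
and comparing Gram determinants gives determinant `1` or `-1`. The formula through `basis.det`
serves to follow a sign change of one vector of `w`. -/
theorem IsOrthFamily.exists_isometry {v w : ℕ → V} (hv : IsOrthFamily f v (Module.finrank K V))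
    (hw : IsOrthFamily f w (Module.finrank K V))
    (hvw : ∀ i < Module.finrank K V, f (w i) (w i) = f (v i) (v i)) :
    ∃ g : V ≃ₗ[K] V, (∀ x y, f (g x) (g y) = f x y) ∧
      (∀ i < Module.finrank K V, g (v i) = w i) ∧
      LinearMap.det (g : V →ₗ[K] V) = hv.basis.det (fun i => w i) ∧
      LinearMap.det (g : V →ₗ[K] V) ^ 2 = 1 := by
  let g := hv.basis.equiv hw.basis (Equiv.refl _)
  have hg : ∀ i, g (hv.basis i) = hw.basis i := fun i => by simp [g]
  have hmat : LinearMap.BilinForm.toMatrix hw.basis f = LinearMap.BilinForm.toMatrix hv.basis f := by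
    ext i j
    rw [LinearMap.BilinForm.toMatrix_apply, LinearMap.BilinForm.toMatrix_apply, hv.basis_apply,
      hv.basis_apply, hw.basis_apply, hw.basis_apply]
    by_cases hij : i = j
    · subst hij; exact hvw i i.2
    · have : (i : ℕ) ≠ j := fun e => hij (Fin.ext e)
      rw [hv.orth i i.2 j j.2 this, hw.orth i i.2 j j.2 this]
  have hdet : LinearMap.det (g : V →ₗ[K] V) = hv.basis.det (fun i => w i) := by
    have := Module.Basis.det_comp hv.basis (g : V →ₗ[K] V) hv.basis
    rw [Module.Basis.det_self, mul_one] at this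
    rw [← this]
    congr 1
    ext i
    simp [hg, hw.basis_apply]
  refine ⟨g, ?_, fun i hi => ?_, hdet, ?_⟩
  · have : LinearMap.BilinForm.comp f (g : V →ₗ[K] V) (g : V →ₗ[K] V) = f := by
      refine LinearMap.BilinForm.ext_basis hv.basis fun i j => ?_
      have := congrFun (congrFun hmat i) j
      rw [LinearMap.BilinForm.toMatrix_apply, LinearMap.BilinForm.toMatrix_apply] at this
      rw [← this, LinearMap.BilinForm.comp_apply]
      simp [hg]
    intro x y
    conv_rhs => rw [← this]
    rfl
  · have := hg ⟨i, hi⟩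
    rwa [hv.basis_apply, hw.basis_apply] at this
  · have h1 := LinearMap.BilinForm.toMatrix_mul_basis_toMatrix hv.basis hw.basis f
    have h2 := congrArg Matrix.det h1
    rw [Matrix.det_mul, Matrix.det_mul, Matrix.det_transpose, hmat] at h2
    have h3 : (LinearMap.BilinForm.toMatrix hv.basis f).det ≠ 0 := by
      have : LinearMap.BilinForm.toMatrix hv.basis f =
          Matrix.diagonal fun i : Fin (Module.finrank K V) => f (v i) (v i) := by
        ext i j
        rw [LinearMap.BilinForm.toMatrix_apply, hv.basis_apply, hv.basis_apply]
        by_cases hij : i = j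
        · subst hij; simp
        · rw [Matrix.diagonal_apply_ne _ hij]
          exact hv.orth i i.2 j j.2 fun e => hij (Fin.ext e)
      rw [this, Matrix.det_diagonal]
      exact Finset.prod_ne_zero_iff.2 fun i _ => hv.ne i i.2
    have h4 : hv.basis.det (fun i => w i) = (hv.basis.toMatrix hw.basis).det := by
      rw [Module.Basis.det_apply]
      congr 2
      ext i
      exact (hw.basis_apply i).symm
    rw [hdet, h4]
    apply mul_left_cancel₀ h3
    linear_combination h2

variable [Finite K]

/-- The special orthogonal group is transitive on nonzero nondegenerate subspaces of given dimension
and discriminant. -/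
theorem exists_isSpecialOrthogonal_map_eq (hodd : Odd (Nat.card K)) (hs : f.IsSymm)
    (hf : f.Nondegenerate) {A B : Submodule K V} (hA : IsNondegOn f A) (hB : IsNondegOn f B)
    (hA0 : A ≠ ⊥) (hAB : Module.finrank K A = Module.finrank K B)
    (hd : IsSquare (discr (f.restrict A) * discr (f.restrict B))) :
    ∃ g : V ≃ₗ[K] V, IsSpecialOrthogonal f g ∧ B = A.map (g : V →ₗ[K] V) := by
  have h2 := two_ne_zero_of_odd_card hodd
  have hT : IsNondegOn f ⊤ := fun x _ h => hf.1 x fun y => h y trivial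
  obtain ⟨k, hk⟩ : ∃ k, k = Module.finrank K A := ⟨_, rfl⟩
  obtain ⟨N, hN⟩ : ∃ N, N = Module.finrank K V := ⟨_, rfl⟩
  have hTN : Module.finrank K (⊤ : Submodule K V) = N := by rw [finrank_top, hN]
  have hkN : k ≤ N := by rw [hk, hN]; exact Submodule.finrank_le A
  have hk0 : 0 < k := by
    rw [hk, Module.finrank_pos_iff]
    exact Submodule.nontrivial_iff_ne_bot.2 hA0
  obtain ⟨v₀, hv₀, hv₀A⟩ := exists_orthFamily_of_isNondegOn h2 hs hA
  rw [← hk] at hv₀ hv₀A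
  obtain ⟨v, hvv, hv, -⟩ := exists_orthFamily_length h2 hs hT hv₀ le_top hkN hTN.ge
  have hvA : spanLT K v k = A := (spanLT_congr hvv).trans hv₀A
  obtain ⟨s, hs0, hdA⟩ := (hv.mono hkN).discr_spanLT
  rw [hvA] at hdA
  obtain ⟨w₀, -, hw₀, hw₀B, hw₀v⟩ := exists_orthFamily_extend hodd hs hB (fun i => f (v i) (v i))
    (fun i hi => hv.ne i (by omega)) (by
      rw [← hAB, ← hk]
      rw [hdA, mul_right_comm, isSquare_mul_sq_iff hs0] at hd
      rwa [mul_comm]) (isOrthFamily_zero fun _ => 0)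
    (spanLT_zero_le _ B) (by simp) (Nat.zero_le _)
  rw [← hAB, ← hk] at hw₀ hw₀B hw₀v
  obtain ⟨t, ht0, hdT⟩ := hv.discr_spanLT
  have hvT : spanLT K v N = ⊤ :=
    Submodule.eq_of_le_of_finrank_eq le_top (by rw [hv.finrank_spanLT, hTN])
  rw [hvT] at hdT
  -- This is Witt extension: the basis of `B` is continued to one of `V` with the norms of `v`,
  -- which is possible since the product of these norms is the discriminant of `V` up to a square.
  obtain ⟨w, hww, hw, -, hwv⟩ := exists_orthFamily_extend hodd hs hT (fun i => f (v i) (v i))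
    (fun i hi => hv.ne i (by omega)) (by
      rw [hTN, hdT, mul_right_comm, isSquare_mul_sq_iff ht0]
      exact ⟨_, rfl⟩) hw₀ le_top hw₀v (by omega)
  rw [hTN] at hw hwv
  have hwB : spanLT K w k = B := (spanLT_congr hww).trans hw₀B
  have map_eq : ∀ (g : V ≃ₗ[K] V) (w' : ℕ → V), (∀ i < N, g (v i) = w' i) →
      A.map (g : V →ₗ[K] V) = spanLT K w' k := by
    intro g w' hg
    rw [← hvA, spanLT, spanLT, Submodule.map_span, ← Set.image_comp]
    congr 1
    exact Set.image_congr fun i hi => hg i (lt_of_lt_of_le hi hkN)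
  subst hN
  obtain ⟨g, hg, hgw, hdet, hsq⟩ := hv.exists_isometry hw hwv
  rcases (by simpa using hsq : LinearMap.det (g : V →ₗ[K] V) = 1 ∨ LinearMap.det (g : V →ₗ[K] V) = -1) with h1 | h1
  · exact ⟨g, ⟨hg, h1⟩, by rw [map_eq g w hgw, hwB]⟩
  -- If the determinant is `-1`, the first vector of `w` is negated. This flips the determinant but
  -- keeps all norms and, as that vector lies in `B`, also the image of `A`.
  · have hval : ∀ i j, (i = j ∨ f (w i) (w j) = 0) →
        f (Function.update w 0 (-w 0) i) (Function.update w 0 (-w 0) j) = f (w i) (w j) := by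
      intro i j hij
      rcases eq_or_ne i 0 with rfl | hi <;> rcases eq_or_ne j 0 with rfl | hj
      · simp
      · have : f (w 0) (w j) = 0 := hij.resolve_left hj.symm
        simp [Function.update_of_ne hj, this]
      · have : f (w i) (w 0) = 0 := hij.resolve_left hi
        simp [Function.update_of_ne hi, this]
      · simp [Function.update_of_ne hj, Function.update_of_ne hi]
    have hw' : IsOrthFamily f (Function.update w 0 (-w 0)) (Module.finrank K V) :=
      ⟨fun i hi => by rw [hval i i (Or.inl rfl)]; exact hw.ne i hi,
        fun i hi j hj hij => by
          rw [hval i j (Or.inr (hw.orth i hi j hj hij))]; exact hw.orth i hi j hj hij⟩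
    obtain ⟨g', hg', hgw', hdet', -⟩ := hv.exists_isometry hw' (fun i hi => by
      rw [hval i i (Or.inl rfl)]; exact hwv i hi)
    have hneg : hv.basis.det (fun i => Function.update w 0 (-w 0) i) =
        - hv.basis.det (fun i => w i) := by
      let i₀ : Fin (Module.finrank K V) := ⟨0, by omega⟩
      have : (fun i : Fin (Module.finrank K V) => Function.update w 0 (-w 0) i) =
          Function.update (fun i : Fin (Module.finrank K V) => w i) i₀ (-w 0) := by
        ext i
        rcases eq_or_ne i i₀ with rfl | hi
        · simp [i₀]
        · rw [Function.update_of_ne hi, Function.update_of_ne fun e => hi (Fin.ext e)]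
      rw [this, AlternatingMap.map_update_neg]
      congr 2
      exact Function.update_eq_self i₀ _
    refine ⟨g', ⟨hg', by rw [hdet', hneg, ← hdet, h1, neg_neg]⟩, ?_⟩
    rw [map_eq g' _ hgw', ← hwB]
    apply le_antisymm <;> rw [spanLT_le] <;> intro i hi <;> rcases eq_or_ne i 0 with rfl | hi0
    · have := mem_spanLT (K := K) (v := Function.update w 0 (-w 0)) hi
      rw [Function.update_self] at this
      simpa using Submodule.neg_mem _ this
    · have := mem_spanLT (K := K) (v := Function.update w 0 (-w 0)) hi
      rwa [Function.update_of_ne hi0] at this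
    · simpa using Submodule.neg_mem _ (mem_spanLT (K := K) (v := w) hi)
    · rw [Function.update_of_ne hi0]
      exact mem_spanLT hi

/-- An orthogonal basis of `A` is extended inside `B` to one vector fewer than needed. At least two
dimensions of `B` are then left, so the norm of the last vector can be chosen to correct the
discriminant. -/
theorem exists_between (hodd : Odd (Nat.card K)) (hs : f.IsSymm)
    {A B W : Submodule K V} (hA : IsNondegOn f A) (hB : IsNondegOn f B) (hW : IsNondegOn f W)
    (hAB : A ≤ B) (h1 : Module.finrank K A < Module.finrank K W)
    (h2 : Module.finrank K W < Module.finrank K B) :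
    ∃ C : Submodule K V, A ≤ C ∧ C ≤ B ∧ IsNondegOn f C ∧
      Module.finrank K C = Module.finrank K W ∧
      IsSquare (discr (f.restrict C) * discr (f.restrict W)) := by
  have hK2 := two_ne_zero_of_odd_card hodd
  obtain ⟨d, hd⟩ : ∃ d, Module.finrank K W = d + 1 := ⟨Module.finrank K W - 1, by omega⟩
  obtain ⟨v₀, hv₀, hv₀A⟩ := exists_orthFamily_of_isNondegOn hK2 hs hA
  obtain ⟨v, hvv, hv, hvB⟩ := exists_orthFamily_length hK2 hs hB hv₀ (by rw [hv₀A]; exact hAB)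
    (j := d) (by omega) (by omega)
  have hP := hv.prod_ne_zero
  have hW0 := discr_restrict_ne_zero hK2 hs hW
  obtain ⟨u, huB, huv, hu⟩ := exists_orth_eq hodd hs hB hv hvB (by omega)
    ((∏ i ∈ Finset.range d, f (v i) (v i)) * discr (f.restrict W))
  have hfam := hv.update hs (by rw [hu]; exact mul_ne_zero hP hW0) huv
  refine ⟨spanLT K (Function.update v d u) (d + 1), ?_, spanLT_update_le hvB huB,
    hfam.isNondegOn_spanLT, by rw [hfam.finrank_spanLT, hd], ?_⟩
  · rw [← hv₀A, spanLT_le]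
    intro i hi
    rw [← hvv i hi]
    have := mem_spanLT (K := K) (v := Function.update v d u) (k := d + 1) (i := i) (by omega)
    rwa [Function.update_of_ne (by omega)] at this
  · obtain ⟨s, hs0, hds⟩ := hfam.discr_spanLT
    rw [Finset.prod_range_succ, Function.update_self, Finset.prod_congr rfl
        (g := fun i => f (v i) (v i)) (fun i hi => by
          rw [Finset.mem_range] at hi
          rw [Function.update_of_ne (by omega)]), hu] at hds
    rw [hds]
    exact ⟨(∏ i ∈ Finset.range d, f (v i) (v i)) * discr (f.restrict W) * s, by ring⟩

/-- In equal dimensions the sign factor and the square or nonsquare convention are the same for both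
forms, and a product of two nonzero scalars is a square exactly when both or neither are. -/
theorem isSquare_discr_mul_of_isPositiveForm_iff (hodd : Odd (Nat.card K))
    {V₁ V₂ : Type*} [AddCommGroup V₁] [Module K V₁] [FiniteDimensional K V₁]
    [AddCommGroup V₂] [Module K V₂] [FiniteDimensional K V₂]
    {f₁ : LinearMap.BilinForm K V₁} {f₂ : LinearMap.BilinForm K V₂}
    (hdim : Module.finrank K V₁ = Module.finrank K V₂) (h₁ : discr f₁ ≠ 0) (h₂ : discr f₂ ≠ 0)
    (h : IsPositiveForm f₁ ↔ IsPositiveForm f₂) : IsSquare (discr f₁ * discr f₂) := by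
  have h1 : ((-1 : K) ^ (Module.finrank K V₂ / 2)) ≠ 0 := pow_ne_zero _ (by simp)
  suffices IsSquare ((-1 : K) ^ (Module.finrank K V₂ / 2) * discr f₁) ↔
      IsSquare ((-1 : K) ^ (Module.finrank K V₂ / 2) * discr f₂) by
    rw [isSquare_mul_iff hodd h1 h₁, isSquare_mul_iff hodd h1 h₂] at this
    rw [isSquare_mul_iff hodd h₁ h₂]
    tauto
  unfold IsPositiveForm at h
  rw [hdim] at h
  have hq : Nat.card K % 4 = 1 ∨ Nat.card K % 4 = 3 := by
    rw [Nat.odd_iff] at hodd; omega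
  by_cases he : Even (Module.finrank K V₂)
  · have ho : ¬ Odd (Module.finrank K V₂) := Nat.not_odd_iff_even.2 he
    simpa [he, ho] using h
  · have ho : Odd (Module.finrank K V₂) := Nat.not_even_iff_odd.1 he
    rcases hq with hq | hq
    · simpa [he, ho, hq] using h
    · simp [he, ho, hq] at h
      tauto

end Transitivity

/-! ### Flags extend to chambers -/

section Geometry

variable {K : Type*} [Field K] [Finite K] {V : Type*} [AddCommGroup V] [Module K V]
  [FiniteDimensional K V] {f : LinearMap.BilinForm K V}

omit [Finite K] [FiniteDimensional K V] in
theorem NondegSubspace.isNondegOn (hs : f.IsSymm) (x : NondegSubspace f) : IsNondegOn f x.1 :=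
  (isNondegOn_iff hs x.1).2 x.2.2.2

theorem mem_orbitSet (hodd : Odd (Nat.card K)) (hs : f.IsSymm) (hf : f.Nondegenerate)
    {W : Set (NondegSubspace f)} {w x : NondegSubspace f} (hw : w ∈ W)
    (hdim : Module.finrank K x.1 = Module.finrank K w.1)
    (hd : IsSquare (discr (f.restrict x.1) * discr (f.restrict w.1))) : x ∈ orbitSet f W := by
  obtain ⟨g, hg, e⟩ := exists_isSpecialOrthogonal_map_eq hodd hs hf (w.isNondegOn hs)
    (x.isNondegOn hs) w.2.1 hdim.symm (by rwa [mul_comm])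
  exact ⟨g, hg, w, hw, e⟩

omit [Finite K] [FiniteDimensional K V] in
theorem finrank_of_mem_orbitSet {W : Set (NondegSubspace f)} {x : NondegSubspace f}
    (hx : x ∈ orbitSet f W) : ∃ w ∈ W, Module.finrank K w.1 = Module.finrank K x.1 := by
  obtain ⟨g, -, w, hw, e⟩ := hx
  refine ⟨w, hw, ?_⟩
  rw [e]
  exact (LinearEquiv.finrank_map_eq g w.1).symm

/-- The pregeometry on the translates of a set of nondegenerate subspaces is a geometry. -/
theorem isGeometry_orthPregeometryOf (hodd : Odd (Nat.card K)) (hs : f.IsSymm)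
    (hf : f.Nondegenerate) (W : Set (NondegSubspace f)) :
    (orthPregeometryOf f W).IsGeometry := by
  intro F hF
  obtain ⟨C, hFC, hCmax⟩ := zorn_subset_nonempty {C | (orthPregeometryOf f W).IsFlag C} (by
    intro c hc hchain _
    refine ⟨⋃₀ c, ?_, fun s => Set.subset_sUnion_of_mem⟩
    rintro x ⟨s, hsc, hxs⟩ y ⟨t, htc, hyt⟩
    rcases hchain.total hsc htc with h | h
    · exact hc htc x (h hxs) y hyt
    · exact hc hsc x hxs y (h hyt)) F hF
  have hC : (orthPregeometryOf f W).IsFlag C := hCmax.prop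
  refine ⟨C, hFC, hC, Set.Subset.antisymm (Set.image_subset_range _ _) ?_⟩
  rintro _ ⟨e, rfl⟩
  set d := Module.finrank K e.1.1 with hd
  show d ∈ _
  by_contra hdC
  have hne : ∀ x ∈ C, Module.finrank K x.1.1 ≠ d := fun x hx h => hdC ⟨x, hx, h⟩
  have comp : ∀ x ∈ C, ∀ y ∈ C, Module.finrank K x.1.1 ≤ Module.finrank K y.1.1 →
      x.1.1 ≤ y.1.1 := by
    intro x hx y hy hxy
    rcases hC x hx y hy with h | h
    · exact h
    · exact (Submodule.eq_of_le_of_finrank_le h hxy).ge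
  have hV : ∀ x : NondegSubspace f, Module.finrank K x.1 < Module.finrank K V :=
    fun x => Submodule.finrank_lt x.2.2.1
  -- If type `d` is missing from the maximal flag, `A` is its largest member of dimension below `d`,
  -- or zero if there is none; `B` below is its smallest member of dimension above `d`, or the whole
  -- space.
  obtain ⟨A, hAnd, hAd, hAC, hA'⟩ : ∃ A : Submodule K V, IsNondegOn f A ∧ Module.finrank K A < d ∧
      (∀ x ∈ C, Module.finrank K x.1.1 < d → x.1.1 ≤ A) ∧
      (∀ x ∈ C, d < Module.finrank K x.1.1 → A ≤ x.1.1) := by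
    by_cases h : ∃ x ∈ C, Module.finrank K x.1.1 < d
    · let S : Set ℕ := {k | ∃ x ∈ C, Module.finrank K x.1.1 < d ∧ Module.finrank K x.1.1 = k}
      have hS : S.Nonempty := by obtain ⟨x, hx, h⟩ := h; exact ⟨_, x, hx, h, rfl⟩
      have hb : BddAbove S := ⟨d, by rintro _ ⟨x, _, h, rfl⟩; exact h.le⟩
      obtain ⟨a, haC, had, ha⟩ := Nat.sSup_mem hS hb
      refine ⟨a.1.1, a.1.isNondegOn hs, had, fun x hx hxd => comp x hx a haC ?_,
        fun x hx hxd => comp a haC x hx (by omega)⟩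
      rw [ha]
      exact le_csSup hb ⟨x, hx, hxd, rfl⟩
    · push Not at h
      refine ⟨⊥, fun x hx _ => by simpa using hx, ?_, fun x hx hxd => absurd (h x hx) (by omega),
        fun _ _ _ => bot_le⟩
      rw [finrank_bot, hd, Module.finrank_pos_iff]
      exact Submodule.nontrivial_iff_ne_bot.2 e.1.2.1
  obtain ⟨B, hBnd, hBd, hBC, hAB⟩ : ∃ B : Submodule K V, IsNondegOn f B ∧ d < Module.finrank K B ∧
      (∀ x ∈ C, d < Module.finrank K x.1.1 → B ≤ x.1.1) ∧ A ≤ B := by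
    by_cases h : ∃ x ∈ C, d < Module.finrank K x.1.1
    · let S : Set ℕ := {k | ∃ x ∈ C, d < Module.finrank K x.1.1 ∧ Module.finrank K x.1.1 = k}
      have hS : S.Nonempty := by obtain ⟨x, hx, h⟩ := h; exact ⟨_, x, hx, h, rfl⟩
      obtain ⟨b, hbC, hbd, hb⟩ := Nat.sInf_mem hS
      refine ⟨b.1.1, b.1.isNondegOn hs, hbd, fun x hx hxd => comp b hbC x hx ?_, hA' b hbC hbd⟩
      rw [hb]
      exact Nat.sInf_le ⟨x, hx, hxd, rfl⟩
    · push Not at h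
      refine ⟨⊤, fun x _ h => hf.1 x fun y => h y trivial, ?_,
        fun x hx hxd => absurd (h x hx) (by omega), le_top⟩
      rw [finrank_top]
      exact hV e.1
  obtain ⟨w, hwW, hwd⟩ := finrank_of_mem_orbitSet e.2
  obtain ⟨D, hAD, hDB, hDnd, hDw, hDsq⟩ := exists_between hodd hs hAnd hBnd (w.isNondegOn hs) hAB
    (by omega) (by omega)
  let D' : NondegSubspace f := ⟨D, by
    rintro rfl; rw [finrank_bot] at hDw; omega, by
    rintro rfl; rw [finrank_top] at hDw; have := hV w; omega, (isNondegOn_iff hs D).1 hDnd⟩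
  let D'' : orbitSet f W := ⟨D', mem_orbitSet hodd hs hf hwW hDw hDsq⟩
  have hDC : ∀ x ∈ C, x.1.1 ≤ D ∨ D ≤ x.1.1 := by
    intro x hx
    rcases lt_or_gt_of_ne (hne x hx) with h | h
    · exact Or.inl ((hAC x hx h).trans hAD)
    · exact Or.inr (hDB.trans (hBC x hx h))
  have hflag : (orthPregeometryOf f W).IsFlag (insert D'' C) := by
    rintro x (rfl | hx) y (rfl | hy)
    · exact Or.inl le_rfl
    · exact (hDC y hy).symm
    · exact hDC x hx
    · exact hC x hx y hy
  have := hCmax.le_of_ge hflag (Set.subset_insert _ _) (Set.mem_insert D'' C)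
  exact hne D'' this (by show Module.finrank K D = d; omega)

end Geometry

end OrthGeom

/-! ### Square and nonsquare discriminants of lines joining a vector to a plane -/

namespace OrthGeom

section Scalars

variable {K : Type*} [Field K] [Finite K]

/-- The norms on an anisotropic plane with diagonal form `⟨μ, ν⟩`, twisted by a vector of norm `q`
having inner products `b` and `c` with the basis, do not all give square discriminants. -/
theorem exists_not_isSquare_discriminant (hodd : Odd (Nat.card K)) {μ ν b c q : K} (hq : q ≠ 0)
    (hμν : ¬ IsSquare (-(μ * ν))) :
    ∃ s t : K, ¬ IsSquare ((s * b + t * c) ^ 2 - (s ^ 2 * μ + t ^ 2 * ν) * q) := by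
  have h2 := two_ne_zero_of_odd_card hodd
  have hμ : μ ≠ 0 := by rintro rfl; simp at hμν
  have hν : ν ≠ 0 := by rintro rfl; simp at hμν
  obtain ⟨n, hn⟩ := exists_not_isSquare (K := K) hodd
  -- The expression is a binary quadratic form in `s, t` with coefficients `b ^ 2 - μ * q`, `2 * b *
  -- c`, `c ^ 2 - ν * q`. If nondegenerate, it takes the nonsquare value `n`. If it has rank one, a
  -- nonzero square value would make `-(μ * ν)` a square.
  by_cases h11 : b ^ 2 - μ * q = 0
  · by_cases h12 : b * c = 0
    · have hb : b ≠ 0 := by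
        rintro rfl
        exact mul_ne_zero hμ hq (by linear_combination -h11)
      have hc : c = 0 := (mul_eq_zero.1 h12).resolve_left hb
      refine ⟨0, 1, fun ⟨r, hr⟩ => hμν ⟨r * μ / b, ?_⟩⟩
      subst hc
      field_simp
      have hbq : b ^ 2 = μ * q := by linear_combination h11
      rw [hbq]
      linear_combination μ * hr
    · have hb : b ≠ 0 := left_ne_zero_of_mul h12
      have hc : c ≠ 0 := right_ne_zero_of_mul h12
      refine ⟨(n - (c ^ 2 - ν * q)) / (2 * b * c), 1, ?_⟩
      convert hn using 2
      field_simp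
      linear_combination ((n - (c ^ 2 - ν * q)) ^ 2) * h11
  · by_cases hdet : (b ^ 2 - μ * q) * (c ^ 2 - ν * q) - (b * c) ^ 2 = 0
    · refine ⟨1, 0, fun ⟨r, hr⟩ => hμν ?_⟩
      have e : (b ^ 2 - μ * q) * ν = -(μ * c ^ 2) := by
        apply mul_left_cancel₀ hq
        linear_combination -hdet
      have hc : c ≠ 0 := by
        rintro rfl
        rcases mul_eq_zero.1 (e.trans (by simp)) with h | h
        · exact h11 h
        · exact hν h
      refine ⟨r * ν / c, ?_⟩
      have e' : r * r * ν = -(μ * c ^ 2) := by rw [← e, ← hr]; ring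
      field_simp
      linear_combination -e'
    · obtain ⟨s, t, h⟩ := exists_sq_add_mul_sq hodd hdet ((b ^ 2 - μ * q) * n)
      refine ⟨(s - b * c * t) / (b ^ 2 - μ * q), t, ?_⟩
      convert hn using 2
      apply mul_left_cancel₀ h11
      rw [← h]
      field_simp
      ring

/-- On a hyperbolic plane with isotropic basis of inner product `h`, some vector together with a
given vector of norm `q` spans a hyperbolic plane. -/
theorem exists_isSquare_discriminant (h2 : (2 : K) ≠ 0) (hcard : 6 ≤ Nat.card K) {a b h q : K}
    (hh : h ≠ 0) (hq : q ≠ 0) :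
    ∃ y s : K, y ≠ 0 ∧ s ≠ 0 ∧ (a + y * b) ^ 2 - 2 * y * h * q = s ^ 2 := by
  -- The equation is the conic `s ^ 2 = a ^ 2 + e * y + b ^ 2 * y ^ 2`. Its point `y = 0`, `s = a`
  -- gives a parametrization by the slope `t` of lines `s = a + t * y`.
  obtain ⟨e, he⟩ : ∃ e, e = 2 * a * b - 2 * h * q := ⟨_, rfl⟩
  have hae : a = 0 → e ≠ 0 := by
    rintro rfl
    rw [he]
    simp [h2, hh, hq]
  obtain ⟨d, hd⟩ : ∃ d, d = b ^ 2 := ⟨_, rfl⟩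
  obtain ⟨k, hk⟩ : ∃ k, k = a * d := ⟨_, rfl⟩
  obtain ⟨a', ha'⟩ : ∃ a', a' = 2 * a := ⟨_, rfl⟩
  -- The slope must avoid the zeros of the common denominator and of the numerators of `y` and `s`;
  -- their product has degree at most five.
  open Polynomial in
  let P : K[X] := (C d - X ^ 2) * ((C a' * X - C e) * (C a * X ^ 2 - C e * X + C k))
  have hP0 : P ≠ 0 := by
    refine mul_ne_zero ?_ (mul_ne_zero ?_ ?_)
    · intro h
      have := congrArg (fun p => Polynomial.coeff p 2) h
      simp [Polynomial.coeff_X_pow] at this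
    · intro h
      have h0 := congrArg (fun p => Polynomial.coeff p 0) h
      have h1 := congrArg (fun p => Polynomial.coeff p 1) h
      simp [ha', h2] at h0 h1
      exact hae h1 h0
    · intro h
      have h1 := congrArg (fun p => Polynomial.coeff p 1) h
      have h3 := congrArg (fun p => Polynomial.coeff p 2) h
      simp [Polynomial.coeff_X_pow, Polynomial.coeff_C] at h1 h3
      exact hae h3 h1
  have hPd : P.natDegree ≤ 5 := by
    simp only [P]
    compute_degree
  obtain ⟨t, ht⟩ := Polynomial.exists_eval_ne_zero_of_natDegree_lt_card P hP0 (by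
    have : Fintype K := Fintype.ofFinite K
    rw [Nat.card_eq_fintype_card] at hcard
    rw [Cardinal.mk_fintype]
    exact_mod_cast (by omega : P.natDegree < Fintype.card K))
  simp only [P, Polynomial.eval_mul, Polynomial.eval_sub, Polynomial.eval_add, Polynomial.eval_pow,
    Polynomial.eval_C, Polynomial.eval_X] at ht
  rw [ha', hk, hd] at ht
  have h1 := left_ne_zero_of_mul ht
  have h3 := left_ne_zero_of_mul (right_ne_zero_of_mul ht)
  have h4 := right_ne_zero_of_mul (right_ne_zero_of_mul ht)
  refine ⟨(2 * a * t - e) / (b ^ 2 - t ^ 2), (a * t ^ 2 - e * t + a * b ^ 2) / (b ^ 2 - t ^ 2),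
    div_ne_zero h3 h1, div_ne_zero h4 h1, ?_⟩
  field_simp
  rw [he]
  ring

end Scalars

/-! ### Common nonzeros of quadratic functions, Gram–Schmidt and projections -/

section Quadratic

variable {K : Type*} [Field K] {V : Type*} [AddCommGroup V] [Module K V]

/-- `g` is quadratic along every affine line. -/
def IsQuadratic (g : V → K) : Prop :=
  ∃ B : V → V → K, ∀ a b t, g (a + t • b) = g a + t * B a b + t ^ 2 * g b

/-- Few nonzero quadratic functions on a subspace have a common nonzero. -/
theorem exists_forall_ne_zero [Finite K] (A : Submodule K V) (gs : List (V → K))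
    (hquad : ∀ g ∈ gs, IsQuadratic g) (hne : ∀ g ∈ gs, ∃ m ∈ A, g m ≠ 0)
    (hcard : 2 * gs.length < Nat.card K) : ∃ m ∈ A, ∀ g ∈ gs, g m ≠ 0 := by
  induction gs with
  | nil => exact ⟨0, A.zero_mem, by simp⟩
  | cons g₀ gs ih =>
    obtain ⟨a, haA, ha⟩ := ih (fun g hg => hquad g (by simp [hg])) (fun g hg => hne g (by simp [hg]))
      (by simp at hcard; omega)
    obtain ⟨b, hbA, hb⟩ := hne g₀ (by simp)
    -- On the line `a + t • b` each function is a polynomial of degree at most two. It is nonzero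
    -- because of its leading coefficient for `g₀` and because of its constant term for the others.
    have hpoly : ∀ g ∈ g₀ :: gs, ∃ P : Polynomial K, P ≠ 0 ∧ P.natDegree ≤ 2 ∧
        ∀ t, P.eval t = g (a + t • b) := by
      intro g hg
      obtain ⟨B, hB⟩ := hquad g hg
      refine ⟨Polynomial.C (g a) + Polynomial.C (B a b) * Polynomial.X +
        Polynomial.C (g b) * Polynomial.X ^ 2, ?_, by compute_degree, fun t => ?_⟩
      · intro h
        have h0 := congrArg (fun p => Polynomial.coeff p 0) h
        have h2 := congrArg (fun p => Polynomial.coeff p 2) h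
        simp [Polynomial.coeff_X, Polynomial.coeff_C] at h0 h2
        rcases List.mem_cons.1 hg with rfl | hg
        · exact hb h2
        · exact ha g hg h0
      · rw [hB]
        simp
        ring
    have hprod : ∀ l : List (V → K), (∀ g ∈ l, g ∈ g₀ :: gs) → ∃ P : Polynomial K, P ≠ 0 ∧
        P.natDegree ≤ 2 * l.length ∧ ∀ t, P.eval t ≠ 0 → ∀ g ∈ l, g (a + t • b) ≠ 0 := by
      intro l
      induction l with
      | nil => exact fun _ => ⟨1, one_ne_zero, by simp, by simp⟩
      | cons g l ihl =>
        intro hl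
        obtain ⟨P, hP, hPd, hPe⟩ := ihl fun g hg => hl g (by simp [hg])
        obtain ⟨R, hR, hRd, hRe⟩ := hpoly g (hl g (by simp))
        refine ⟨R * P, mul_ne_zero hR hP, (Polynomial.natDegree_mul_le).trans (by simp; omega), ?_⟩
        intro t ht g' hg'
        rw [Polynomial.eval_mul] at ht
        rcases List.mem_cons.1 hg' with rfl | hg'
        · rw [← hRe]; exact left_ne_zero_of_mul ht
        · exact hPe t (right_ne_zero_of_mul ht) g' hg'
    obtain ⟨P, hP, hPd, hPe⟩ := hprod (g₀ :: gs) fun g hg => hg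
    obtain ⟨t, ht⟩ := Polynomial.exists_eval_ne_zero_of_natDegree_lt_card P hP (by
      have : Fintype K := Fintype.ofFinite K
      rw [Nat.card_eq_fintype_card] at hcard
      rw [Cardinal.mk_fintype]
      exact_mod_cast (by omega : P.natDegree < Fintype.card K))
    exact ⟨_, A.add_mem haA (A.smul_mem t hbA), hPe t ht⟩

variable {f : LinearMap.BilinForm K V}

theorem gram_comm (hs : f.IsSymm) (x y : V) : gram f x y = gram f y x := by
  rw [gram, gram, hs.eq x y]; ring

theorem isQuadratic_self : IsQuadratic (fun m => f m m) :=
  ⟨fun a b => f a b + f b a, fun a b t => by simp; ring⟩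

theorem isQuadratic_gram (x : V) : IsQuadratic (fun m => gram f m x) :=
  ⟨fun a b => (f a b + f b a) * f x x - 2 * f a x * f b x, fun a b t => by simp [gram]; ring⟩

/-- If the Gram determinant with `x` vanished on `m`, `n` and `m + n`, polarization would give `f m
x * f n x = 0`; but neither factor is zero, since their squares are `f m m * f x x` and `f n n * f x
x`. -/
theorem exists_gram_ne_zero (h2 : (2 : K) ≠ 0) (hs : f.IsSymm) {A : Submodule K V} {m n x : V}
    (hm : m ∈ A) (hn : n ∈ A) (hmm : f m m ≠ 0) (hnn : f n n ≠ 0) (hmn : f m n = 0)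
    (hx : f x x ≠ 0) : ∃ a ∈ A, gram f a x ≠ 0 := by
  by_contra! h
  have h1 := h m hm
  have h3 := h n hn
  have h4 := h (m + n) (A.add_mem hm hn)
  have hnm : f n m = 0 := (hs.eq n m).trans hmn
  simp only [gram, map_add, LinearMap.add_apply, hmn, hnm] at h1 h3 h4
  have : 2 * (f m x * f n x) = 0 := by linear_combination h1 + h3 - h4
  rcases mul_eq_zero.1 ((mul_eq_zero.1 this).resolve_left h2) with h | h
  · exact mul_ne_zero hmm hx (by linear_combination h1 + f m x * h)
  · exact mul_ne_zero hnn hx (by linear_combination h3 + f n x * h)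

theorem isOrthFamily_singleton {x : V} (hx : f x x ≠ 0) : IsOrthFamily f (fun _ => x) 1 :=
  ⟨fun _ _ => hx, fun i hi j hj hij => by omega⟩

theorem exists_orthFamily_pair (hs : f.IsSymm) {x y : V} (hx : f x x ≠ 0) (hg : gram f x y ≠ 0) :
    ∃ v : ℕ → V, IsOrthFamily f v 2 ∧ spanLT K v 2 = Submodule.span K {x, y} ∧
      f (v 0) (v 0) * f (v 1) (v 1) = gram f x y := by
  have hyx := hs.eq y x
  set y' := y - (f x y / f x x) • x with hy'
  have e : f y' x = 0 := by
    rw [hy']; simp only [map_sub, LinearMap.sub_apply, map_smul, LinearMap.smul_apply, smul_eq_mul]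
    rw [hyx]; field_simp; ring
  have e2 : f x x * f y' y' = gram f x y := by
    rw [hy', gram]; simp only [map_sub, LinearMap.sub_apply, map_smul, LinearMap.smul_apply,
      smul_eq_mul]
    rw [hyx]; field_simp; ring
  refine ⟨Function.update (fun _ => x) 1 y', (isOrthFamily_singleton hx).update hs
    (right_ne_zero_of_mul (e2 ▸ hg)) (fun i _ => e), ?_, by simpa using e2⟩
  apply le_antisymm
  · rw [spanLT_le]
    intro i hi
    interval_cases i
    · simpa using Submodule.subset_span (Set.mem_insert x {y})
    · rw [Function.update_self]
      exact Submodule.sub_mem _ (Submodule.subset_span (by simp))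
        (Submodule.smul_mem _ _ (Submodule.subset_span (by simp)))
  · have hxm : x ∈ spanLT K (Function.update (fun _ => x) 1 y') 2 := by
      simpa using mem_spanLT (K := K) (v := Function.update (fun _ => x) 1 y') (k := 2) (i := 0)
        (by norm_num)
    have hym : y' ∈ spanLT K (Function.update (fun _ => x) 1 y') 2 := by
      simpa using mem_spanLT (K := K) (v := Function.update (fun _ => x) 1 y') (k := 2) (i := 1)
        (by norm_num)
    rw [Submodule.span_le]
    rintro z (rfl | rfl)
    · exact hxm
    · have : z = y' + (f x z / f x x) • x := by rw [hy']; abel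
      rw [SetLike.mem_coe, this]
      exact Submodule.add_mem _ hym (Submodule.smul_mem _ _ hxm)

theorem exists_orthFamily_four (hs : f.IsSymm) {x y u z : V} (hx : f x x ≠ 0) (hu : f u u ≠ 0)
    (hxy : gram f x y ≠ 0) (huz : gram f u z ≠ 0) (hux : f u x = 0) (huy : f u y = 0)
    (hzx : f z x = 0) (hzy : f z y = 0) :
    ∃ v : ℕ → V, IsOrthFamily f v 4 ∧ spanLT K v 4 = Submodule.span K {x, y, u, z} ∧
      ∏ i ∈ Finset.range 4, f (v i) (v i) = gram f x y * gram f u z := by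
  obtain ⟨v, hv, hvs, hvp⟩ := exists_orthFamily_pair hs hx hxy
  obtain ⟨w, hw, hws, hwp⟩ := exists_orthFamily_pair hs hu huz
  have hv' : ∀ i < 2, v i ∈ Submodule.span K {x, y} := fun i hi => hvs ▸ mem_spanLT hi
  have hw' : ∀ i < 2, w i ∈ Submodule.span K {u, z} := fun i hi => hws ▸ mem_spanLT hi
  have perp : ∀ i < 2, ∀ j < 2, f (w i) (v j) = 0 := by
    intro i hi j hj
    obtain ⟨a, b, e⟩ := Submodule.mem_span_pair.1 (hw' i hi)
    obtain ⟨c, d, e'⟩ := Submodule.mem_span_pair.1 (hv' j hj)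
    rw [← e, ← e']
    simp [hux, huy, hzx, hzy]
  have h3 := hv.update hs (hw.ne 0 (by norm_num)) fun i hi => perp 0 (by norm_num) i hi
  have h4 := h3.update hs (hw.ne 1 (by norm_num)) fun i hi => by
    rcases eq_or_ne i 2 with rfl | h
    · rw [Function.update_self]; exact hw.orth 1 (by norm_num) 0 (by norm_num) (by norm_num)
    · rw [Function.update_of_ne h]; exact perp 1 (by norm_num) i (by omega)
  refine ⟨_, h4, ?_, ?_⟩
  · have hsup : Submodule.span K {x, y, u, z} =
        Submodule.span K {x, y} ⊔ Submodule.span K {u, z} := by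
      rw [← Submodule.span_union]
      congr 1
      ext t
      simp only [Set.mem_insert_iff, Set.mem_singleton_iff, Set.mem_union]
      tauto
    rw [hsup, ← hvs, ← hws]
    set F := Function.update (Function.update v 2 (w 0)) (2 + 1) (w 1)
    have m0 : v 0 ∈ spanLT K F 4 := by
      simpa [F] using mem_spanLT (K := K) (v := F) (k := 4) (i := 0) (by norm_num)
    have m1 : v 1 ∈ spanLT K F 4 := by
      simpa [F] using mem_spanLT (K := K) (v := F) (k := 4) (i := 1) (by norm_num)
    have m2 : w 0 ∈ spanLT K F 4 := by
      simpa [F] using mem_spanLT (K := K) (v := F) (k := 4) (i := 2) (by norm_num)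
    have m3 : w 1 ∈ spanLT K F 4 := by
      simpa [F] using mem_spanLT (K := K) (v := F) (k := 4) (i := 3) (by norm_num)
    apply le_antisymm
    · rw [spanLT_le]
      intro i hi
      interval_cases i
      · simpa [F] using Submodule.mem_sup_left (mem_spanLT (by norm_num))
      · simpa [F] using Submodule.mem_sup_left (mem_spanLT (by norm_num))
      · simpa [F] using Submodule.mem_sup_right (mem_spanLT (by norm_num))
      · simpa [F] using Submodule.mem_sup_right (mem_spanLT (by norm_num))
    · rw [sup_le_iff, spanLT_le, spanLT_le]
      constructor <;> intro i hi <;> interval_cases i <;> assumption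
  · rw [← hvp, ← hwp]
    simp [Finset.prod_range_succ]
    ring

/-- The orthogonal projection onto a nondegenerate plane. -/
theorem exists_orth_proj (hs : f.IsSymm) {x y : V} (hg : gram f x y ≠ 0) (z : V) :
    ∃ a b : K, f (z - a • x - b • y) x = 0 ∧ f (z - a • x - b • y) y = 0 ∧
      f (z - a • x - b • y) (z - a • x - b • y) * gram f x y =
        f x x * f y y * f z z + 2 * f y z * f x z * f x y - f x x * f y z ^ 2 - f y y * f x z ^ 2 -
          f z z * f x y ^ 2 := by
  have e1 := hs.eq y x
  have e2 := hs.eq z x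
  have e3 := hs.eq z y
  -- Cramer's rule. The third identity says that the norm of the projected vector times `gram f x y`
  -- is the Gram determinant of `x, y, z`.
  refine ⟨(f x z * f y y - f y z * f x y) / gram f x y,
    (f y z * f x x - f x z * f x y) / gram f x y, ?_, ?_, ?_⟩ <;>
  simp only [map_sub, LinearMap.sub_apply, map_smul, LinearMap.smul_apply, smul_eq_mul, e1, e2, e3] <;>
  field_simp <;> rw [gram] <;> ring

end Quadratic

end OrthGeom

/-! ### Rich families, hubs and common neighbours -/

namespace OrthGeom

variable {K : Type*} [Field K] {V : Type*} [AddCommGroup V] [Module K V]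
  {f : LinearMap.BilinForm K V}

/-- A set of nondegenerate subspaces containing all anisotropic points, all elliptic lines and all
hyperbolic four-dimensional subspaces. -/
structure IsRich (f : LinearMap.BilinForm K V) (Y : Set (Submodule K V)) : Prop where
  nondeg : ∀ A ∈ Y, IsNondegOn f A
  ne_bot : ∀ A ∈ Y, A ≠ ⊥
  point : ∀ x, f x x ≠ 0 → Submodule.span K {x} ∈ Y
  line : ∀ x y, ¬ IsSquare (f x y ^ 2 - f x x * f y y) → Submodule.span K {x, y} ∈ Y
  four : ∀ x y u z, f x x ≠ 0 → f u u ≠ 0 → gram f x y ≠ 0 → gram f u z ≠ 0 →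
    f u x = 0 → f u y = 0 → f z x = 0 → f z y = 0 → IsSquare (gram f x y * gram f u z) →
    Submodule.span K {x, y, u, z} ∈ Y

theorem span_pair_le {x y : V} {A : Submodule K V} (hx : x ∈ A) (hy : y ∈ A) :
    Submodule.span K {x, y} ≤ A := by
  rw [Submodule.span_le]
  rintro z (rfl | rfl)
  · exact hx
  · exact hy

theorem span_singleton_le' {x : V} {A : Submodule K V} (hx : x ∈ A) :
    Submodule.span K {x} ≤ A := (Submodule.span_singleton_le_iff_mem x A).2 hx

theorem spanLT_const_one (x : V) : spanLT K (fun _ : ℕ => x) 1 = Submodule.span K {x} := by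
  rw [spanLT]
  congr 1
  ext t
  simp only [Set.mem_image, Set.mem_Iio, Set.mem_singleton_iff]
  exact ⟨fun ⟨_, _, h⟩ => h.symm, fun h => ⟨0, by norm_num, h.symm⟩⟩

section Reach

variable [FiniteDimensional K V] [Finite K]

omit [Finite K] in
/-- Two vectors orthogonal to a given orthogonal family. -/
theorem exists_orth_pair (h2 : (2 : K) ≠ 0) (hs : f.IsSymm) (hf : f.Nondegenerate)
    {v : ℕ → V} {k : ℕ} (hv : IsOrthFamily f v k) (hk : k + 2 ≤ Module.finrank K V) :
    ∃ m n : V, (∀ s ∈ spanLT K v k, f m s = 0) ∧ (∀ s ∈ spanLT K v k, f n s = 0) ∧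
      f m m ≠ 0 ∧ f n n ≠ 0 ∧ f m n = 0 := by
  have hT : IsNondegOn f ⊤ := fun x _ h => hf.1 x fun y => h y trivial
  obtain ⟨w, hwv, hw, -⟩ := exists_orthFamily_length h2 hs hT hv le_top (j := k + 2) (by omega)
    (by rw [finrank_top]; omega)
  refine ⟨w k, w (k + 1), orth_spanLT fun i hi => ?_, orth_spanLT fun i hi => ?_,
    hw.ne _ (by omega), hw.ne _ (by omega), hw.orth _ (by omega) _ (by omega) (by omega)⟩
  · rw [← hwv i hi]; exact hw.orth _ (by omega) _ (by omega) (by omega)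
  · rw [← hwv i hi]; exact hw.orth _ (by omega) _ (by omega) (by omega)

variable {Y : Set (Submodule K V)}

/-- The hub is the line `⟨x, y⟩` plus an orthogonal plane of the same discriminant. Every
anisotropic `u` orthogonal to the line can be paired with a vector `z` of that plane such that `⟨x,
y, u, z⟩` is again hyperbolic. It then shares the plane `⟨x, y, z⟩` with the hub. -/
theorem IsRich.exists_hub (hY : IsRich f Y) (hodd : Odd (Nat.card K)) (hcard : 6 ≤ Nat.card K)
    (hs : f.IsSymm) (hf : f.Nondegenerate) (hdim : 5 ≤ Module.finrank K V) {x y : V}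
    (hx : f x x ≠ 0) (hxy : gram f x y ≠ 0) :
    ∃ M ∈ Y, x ∈ M ∧ y ∈ M ∧ (∃ u, f u x = 0 ∧ f u y = 0 ∧ f u u ≠ 0) ∧
      ∀ u, f u x = 0 → f u y = 0 → f u u ≠ 0 → ∃ z ∈ M, f z x = 0 ∧ f z y = 0 ∧ f z z ≠ 0 ∧
        gram f u z ≠ 0 ∧ IsSquare (gram f x y * gram f u z) := by
  have h2 := two_ne_zero_of_odd_card hodd
  have hT : IsNondegOn f ⊤ := fun x _ h => hf.1 x fun y => h y trivial
  obtain ⟨v, hv, hvs, -⟩ := exists_orthFamily_pair hs hx hxy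
  obtain ⟨w, hwv, hw, -⟩ := exists_orthFamily_length h2 hs hT hv le_top (j := 5) (by omega)
    (by rw [finrank_top]; omega)
  have perp : ∀ i < 5, 2 ≤ i → f (w i) x = 0 ∧ f (w i) y = 0 := by
    intro i hi hi2
    have : ∀ s ∈ spanLT K v 2, f (w i) s = 0 := orth_spanLT fun j hj => by
      rw [← hwv j hj]; exact hw.orth i hi j (by omega) (by omega)
    rw [hvs] at this
    exact ⟨this x (Submodule.subset_span (by simp)), this y (Submodule.subset_span (by simp))⟩
  obtain ⟨p2, q2⟩ := perp 2 (by norm_num) le_rfl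
  obtain ⟨p3, q3⟩ := perp 3 (by norm_num) (by norm_num)
  obtain ⟨p4, q4⟩ := perp 4 (by norm_num) (by norm_num)
  have n2 := hw.ne 2 (by norm_num)
  have n3 := hw.ne 3 (by norm_num)
  have n4 := hw.ne 4 (by norm_num)
  have o23 := hw.orth 2 (by norm_num) 3 (by norm_num) (by norm_num)
  have o42 := hw.orth 4 (by norm_num) 2 (by norm_num) (by norm_num)
  have o43 := hw.orth 4 (by norm_num) 3 (by norm_num) (by norm_num)
  have hm : ∀ c, ∃ m, f m x = 0 ∧ f m y = 0 ∧ f (w 4) m = 0 ∧ f m m = c := by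
    intro c
    obtain ⟨a, b, h⟩ := exists_smul_add_smul_eq hodd hs n2 (y := w 3) (by
      simp [gram, o23, n2, n3]) c
    exact ⟨_, by simp [p2, p3], by simp [q2, q3], by simp [o42, o43], h⟩
  by_cases hsq : IsSquare (-gram f x y)
  · obtain ⟨m, mx, my, hm4, hmm⟩ := hm (-f (w 4) (w 4))
    have h4m : f m (w 4) = 0 := (hs.eq _ _).trans hm4
    have hg : gram f (w 4) m = -f (w 4) (w 4) ^ 2 := by rw [gram, hm4, hmm]; ring
    have hMY := hY.four x y (w 4) m hx n4 hxy (by rw [hg]; simpa using n4) p4 q4 mx my (by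
      rw [hg, show gram f x y * -f (w 4) (w 4) ^ 2 = -gram f x y * f (w 4) (w 4) ^ 2 by ring,
        isSquare_mul_sq_iff n4]
      exact hsq)
    refine ⟨_, hMY, Submodule.subset_span (by simp), Submodule.subset_span (by simp),
      ⟨_, p4, q4, n4⟩, fun u ux uy hu => ?_⟩
    -- For a hyperbolic line the orthogonal plane is hyperbolic, with isotropic basis `w 4 + m`, `w
    -- 4 - m` of inner product `2 * f (w 4) (w 4)`. The vector `z` must make `-gram f u z` a square.
    obtain ⟨t, s, ht, hs0, hts⟩ := exists_isSquare_discriminant (K := K) h2 hcard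
      (a := f (w 4 + m) u) (b := f (w 4 - m) u) (h := 2 * f (w 4) (w 4)) (q := f u u)
      (mul_ne_zero h2 n4) hu
    have h4M : w 4 ∈ Submodule.span K {x, y, w 4, m} := Submodule.subset_span (by simp)
    have hmM : m ∈ Submodule.span K {x, y, w 4, m} := Submodule.subset_span (by simp)
    have hzz : f ((w 4 + m) + t • (w 4 - m)) ((w 4 + m) + t • (w 4 - m)) =
        2 * t * (2 * f (w 4) (w 4)) := by
      simp [hm4, h4m, hmm]; ring
    have hzu : f u ((w 4 + m) + t • (w 4 - m)) = f (w 4 + m) u + t * f (w 4 - m) u := by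
      rw [hs.eq]; simp
    have hgz : gram f u ((w 4 + m) + t • (w 4 - m)) = -s ^ 2 := by
      rw [gram, hzu, hzz, ← hts]; ring
    refine ⟨(w 4 + m) + t • (w 4 - m), Submodule.add_mem _ (Submodule.add_mem _ h4M hmM)
      (Submodule.smul_mem _ _ (Submodule.sub_mem _ h4M hmM)), by simp [p4, mx], by simp [q4, my],
      ?_, ?_, ?_⟩
    · rw [hzz]; exact mul_ne_zero (mul_ne_zero h2 ht) (mul_ne_zero h2 n4)
    · rw [hgz]; simpa using hs0
    · rw [hgz, show gram f x y * -s ^ 2 = -gram f x y * s ^ 2 by ring, isSquare_mul_sq_iff hs0]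
      exact hsq
  · obtain ⟨m, mx, my, hm4, hmm⟩ := hm (gram f x y / f (w 4) (w 4))
    have hg : gram f (w 4) m = gram f x y := by rw [gram, hm4, hmm]; field_simp; ring
    have hMY := hY.four x y (w 4) m hx n4 hxy (by rwa [hg]) p4 q4 mx my (by
      rw [hg]; exact ⟨_, rfl⟩)
    refine ⟨_, hMY, Submodule.subset_span (by simp), Submodule.subset_span (by simp),
      ⟨_, p4, q4, n4⟩, fun u ux uy hu => ?_⟩
    -- For an elliptic line the orthogonal plane is elliptic, and `-gram f u z` has to be a
    -- nonsquare.
    obtain ⟨s, t, hst⟩ := exists_not_isSquare_discriminant hodd (μ := f (w 4) (w 4)) (ν := f m m)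
      (b := f (w 4) u) (c := f m u) hu (by
        rw [show f (w 4) (w 4) * f m m = gram f x y by rw [← hg, gram, hm4]; ring]; exact hsq)
    have h4M : w 4 ∈ Submodule.span K {x, y, w 4, m} := Submodule.subset_span (by simp)
    have hmM : m ∈ Submodule.span K {x, y, w 4, m} := Submodule.subset_span (by simp)
    have h4m : f m (w 4) = 0 := (hs.eq _ _).trans hm4
    have hzz : f (s • w 4 + t • m) (s • w 4 + t • m) =
        s ^ 2 * f (w 4) (w 4) + t ^ 2 * f m m := by
      simp [hm4, h4m]; ring
    have hzu : f u (s • w 4 + t • m) = s * f (w 4) u + t * f m u := by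
      rw [hs.eq]; simp
    have hgz : -gram f u (s • w 4 + t • m) = (s * f (w 4) u + t * f m u) ^ 2 -
        (s ^ 2 * f (w 4) (w 4) + t ^ 2 * f m m) * f u u := by
      rw [gram, hzu, hzz]; ring
    rw [← hgz] at hst
    refine ⟨s • w 4 + t • m, Submodule.add_mem _ (Submodule.smul_mem _ _ h4M)
      (Submodule.smul_mem _ _ hmM), by simp [p4, mx], by simp [q4, my], ?_, ?_, ?_⟩
    · intro h0
      rw [gram, h0] at hst
      exact hst ⟨f u (s • w 4 + t • m), by ring⟩
    · intro h0
      rw [h0] at hst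
      simp at hst
    · have hne : gram f u (s • w 4 + t • m) ≠ 0 := by
        intro h0
        rw [h0] at hst
        simp at hst
      rw [← neg_mul_neg, isSquare_mul_iff hodd (neg_ne_zero.2 hxy) (neg_ne_zero.2 hne)]
      tauto

/-- Every vector orthogonal to a nondegenerate line lies with the line in a member of `Y`. -/
theorem IsRich.exists_mem_three (hY : IsRich f Y) (hodd : Odd (Nat.card K))
    (hcard : 6 ≤ Nat.card K) (hs : f.IsSymm) (hf : f.Nondegenerate)
    (hdim : 5 ≤ Module.finrank K V) {x y u : V} (hx : f x x ≠ 0) (hxy : gram f x y ≠ 0)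
    (ux : f u x = 0) (uy : f u y = 0) (hu : f u u ≠ 0) :
    ∃ E ∈ Y, x ∈ E ∧ y ∈ E ∧ u ∈ E := by
  obtain ⟨M, -, -, -, -, hM⟩ := hY.exists_hub hodd hcard hs hf hdim hx hxy
  obtain ⟨z, -, zx, zy, -, hg, hsq⟩ := hM u ux uy hu
  exact ⟨_, hY.four x y u z hx hu hxy hg ux uy zx zy hsq, Submodule.subset_span (by simp),
    Submodule.subset_span (by simp), Submodule.subset_span (by simp)⟩

/-- Four anisotropic vectors have a common neighbour spanning nondegenerate lines with each of them. -/
theorem exists_common_neighbour (hodd : Odd (Nat.card K)) (hcard : 9 ≤ Nat.card K)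
    (hs : f.IsSymm) (hf : f.Nondegenerate) (hdim : 5 ≤ Module.finrank K V) {o x m n : V}
    (ho : f o o ≠ 0) (hx : f x x ≠ 0) (hm : f m m ≠ 0) (hn : f n n ≠ 0) :
    ∃ w, f w w ≠ 0 ∧ gram f w o ≠ 0 ∧ gram f w x ≠ 0 ∧ gram f w m ≠ 0 ∧ gram f w n ≠ 0 := by
  have h2 := two_ne_zero_of_odd_card hodd
  -- The span of `o` and `x` may be degenerate, with radical spanned by some `r`. It still lies in a
  -- nondegenerate subspace of dimension at most three, whose complement has dimension at least two.
  have hfam : ∃ (v : ℕ → V) (k : ℕ), IsOrthFamily f v k ∧ k ≤ 3 ∧ o ∈ spanLT K v k ∧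
      x ∈ spanLT K v k := by
    by_cases hox : gram f o x = 0
    · obtain ⟨r, hr⟩ : ∃ r, r = x - (f o x / f o o) • o := ⟨_, rfl⟩
      have hxo := hs.eq x o
      have hro : f r o = 0 := by
        rw [hr]; simp only [map_sub, LinearMap.sub_apply, map_smul, LinearMap.smul_apply,
          smul_eq_mul, hxo]
        field_simp; ring
      have hrr : f r r = 0 := by
        have : f o o * f r r = gram f o x := by
          rw [hr, gram]; simp only [map_sub, LinearMap.sub_apply, map_smul, LinearMap.smul_apply,
            smul_eq_mul, hxo]
          field_simp; ring
        rw [hox] at this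
        exact (mul_eq_zero.1 this).resolve_left ho
      have hxr : x = r + (f o x / f o o) • o := by rw [hr]; abel
      by_cases hr0 : r = 0
      · refine ⟨fun _ => o, 1, isOrthFamily_singleton ho, by norm_num,
          mem_spanLT (v := fun _ => o) (k := 1) (i := 0) (by norm_num), ?_⟩
        rw [hxr, hr0, zero_add]
        exact Submodule.smul_mem _ _ (mem_spanLT (v := fun _ => o) (k := 1) (i := 0) (by norm_num))
      · obtain ⟨v, hv⟩ : ∃ v, f r v ≠ 0 := by
          by_contra! h
          exact hr0 (hf.1 r h)
        obtain ⟨v', hv'⟩ : ∃ v', v' = v - (f v o / f o o) • o := ⟨_, rfl⟩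
        have hv'o : f v' o = 0 := by
          rw [hv']; simp only [map_sub, LinearMap.sub_apply, map_smul, LinearMap.smul_apply,
            smul_eq_mul]
          field_simp; ring
        have hrv' : f r v' = f r v := by rw [hv']; simp [hro]
        have hv'r : f v' r = f r v := (hs.eq _ _).trans hrv'
        -- The multiple of `r` normalizes `p` to norm one. Then `p` and `r - f r v • p` are
        -- orthogonal, and they span a hyperbolic plane containing `r`.
        obtain ⟨p, hp⟩ : ∃ p, p = ((1 - f v' v') / (2 * f r v)) • r + v' := ⟨_, rfl⟩
        have hpp : f p p = 1 := by
          rw [hp]; simp only [map_add, LinearMap.add_apply, map_smul, LinearMap.smul_apply,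
            smul_eq_mul, hrr, hrv', hv'r]
          field_simp; ring
        have hpr : f p r = f r v := by rw [hp]; simp [hrr, hv'r]
        have hpo : f p o = 0 := by rw [hp]; simp [hro, hv'o]
        have hop : f o p = 0 := (hs.eq _ _).trans hpo
        have hor : f o r = 0 := (hs.eq _ _).trans hro
        have hrp : f r p = f r v := (hs.eq _ _).trans hpr
        have h1 := (isOrthFamily_singleton ho).update hs (u := p) (by simp [hpp]) fun i _ => hpo
        have h3 := h1.update hs (u := r - f r v • p) (by simp [hrr, hrp, hpr, hpp, hv]) (by
          intro i hi
          interval_cases i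
          · simp [hro, hpo]
          · simp [hrp, hpp])
        set F := Function.update (Function.update (fun _ => o) 1 p) (1 + 1) (r - f r v • p)
        have m0 : o ∈ spanLT K F 3 := by
          simpa [F] using mem_spanLT (K := K) (v := F) (k := 3) (i := 0) (by norm_num)
        have m1 : p ∈ spanLT K F 3 := by
          simpa [F] using mem_spanLT (K := K) (v := F) (k := 3) (i := 1) (by norm_num)
        have m2 : r - f r v • p ∈ spanLT K F 3 := by
          simpa [F] using mem_spanLT (K := K) (v := F) (k := 3) (i := 2) (by norm_num)
        refine ⟨F, 3, h3, le_rfl, m0, ?_⟩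
        have : x = (r - f r v • p) + f r v • p + (f o x / f o o) • o := by
          rw [sub_add_cancel]; exact hxr
        rw [this]
        exact Submodule.add_mem _ (Submodule.add_mem _ m2 (Submodule.smul_mem _ _ m1))
          (Submodule.smul_mem _ _ m0)
    · obtain ⟨v, hv, hvs, -⟩ := exists_orthFamily_pair hs ho hox
      exact ⟨v, 2, hv, by norm_num, hvs ▸ Submodule.subset_span (by simp),
        hvs ▸ Submodule.subset_span (by simp)⟩
  obtain ⟨v, k, hv, hk, hov, hxv⟩ := hfam
  obtain ⟨a, b, ha, hb, haa, hbb, hab⟩ := exists_orth_pair h2 hs hf hv (by omega)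
  have haA : a ∈ LinearMap.ker (f.flip o) ⊓ LinearMap.ker (f.flip x) := ⟨ha o hov, ha x hxv⟩
  have hbA : b ∈ LinearMap.ker (f.flip o) ⊓ LinearMap.ker (f.flip x) := ⟨hb o hov, hb x hxv⟩
  -- For `w` orthogonal to `o` and `x`, anisotropy alone settles the lines to these two. Three
  -- quadratic conditions remain, which requires more than six scalars.
  obtain ⟨w, ⟨hwo, hwx⟩, hw⟩ := exists_forall_ne_zero
    (LinearMap.ker (f.flip o) ⊓ LinearMap.ker (f.flip x))
    [fun w => f w w, fun w => gram f w m, fun w => gram f w n] (by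
      simp only [List.forall_mem_cons]
      exact ⟨isQuadratic_self, isQuadratic_gram m, isQuadratic_gram n, by simp⟩) (by
      simp only [List.forall_mem_cons]
      exact ⟨⟨a, haA, haa⟩, exists_gram_ne_zero h2 hs haA hbA haa hbb hab hm,
        exists_gram_ne_zero h2 hs haA hbA haa hbb hab hn, by simp⟩) (by simp; omega)
  simp only [List.forall_mem_cons] at hw
  have hwo' : f w o = 0 := hwo
  have hwx' : f w x = 0 := hwx
  refine ⟨w, hw.1, ?_, ?_, hw.2.1, hw.2.2.1⟩
  · simp [gram, hwo', hw.1, ho]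
  · simp [gram, hwx', hw.1, hx]

end Reach

/-! ### Holonomy of a cocycle and its integration -/

section Cocycle

variable {Y : Set (Submodule K V)} {H : Type*} [Group H] {φ : Submodule K V → Submodule K V → H}

/-- The holonomy of the cocycle from `x` to `y` through `A`. -/
def holonomy (φ : Submodule K V → Submodule K V → H) (A : Submodule K V) (x y : V) : H :=
  φ (Submodule.span K {x}) A * (φ (Submodule.span K {y}) A)⁻¹

theorem holonomy_mul (A : Submodule K V) (x y z : V) :
    holonomy φ A x y * holonomy φ A y z = holonomy φ A x z := by
  simp [holonomy, mul_assoc]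

/-- A cocycle on nested members of `Y`. -/
def IsCocycleOn (Y : Set (Submodule K V)) (φ : Submodule K V → Submodule K V → H) : Prop :=
  ∀ A ∈ Y, ∀ B ∈ Y, ∀ C ∈ Y, A ≤ B → B ≤ C → φ A B * φ B C = φ A C

namespace IsRich

variable (hY : IsRich f Y) (hφ : IsCocycleOn Y φ)

include hY hφ

theorem holonomy_mono {A B : Submodule K V} (hA : A ∈ Y) (hB : B ∈ Y) (hAB : A ≤ B) {x y : V}
    (hx : f x x ≠ 0) (hy : f y y ≠ 0) (hxA : x ∈ A) (hyA : y ∈ A) :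
    holonomy φ A x y = holonomy φ B x y := by
  rw [holonomy, holonomy, ← hφ _ (hY.point x hx) A hA B hB (span_singleton_le' hxA) hAB,
    ← hφ _ (hY.point y hy) A hA B hB (span_singleton_le' hyA) hAB]
  group

/-- The elliptic line `⟨x, y⟩` is itself a member contained in both `A` and `B`. -/
theorem holonomy_eq_of_not_isSquare {A B : Submodule K V} (hA : A ∈ Y) (hB : B ∈ Y) {x y : V}
    (hxy : ¬ IsSquare (f x y ^ 2 - f x x * f y y)) (hxA : x ∈ A) (hyA : y ∈ A)
    (hxB : x ∈ B) (hyB : y ∈ B) : holonomy φ A x y = holonomy φ B x y := by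
  have hx : f x x ≠ 0 := fun h => hxy (by rw [h]; exact ⟨f x y, by ring⟩)
  have hy : f y y ≠ 0 := fun h => hxy (by rw [h]; exact ⟨f x y, by ring⟩)
  have hl := hY.line x y hxy
  have hxl : x ∈ Submodule.span K {x, y} := Submodule.subset_span (by simp)
  have hyl : y ∈ Submodule.span K {x, y} := Submodule.subset_span (by simp)
  rw [← hY.holonomy_mono hφ hl hA (span_pair_le hxA hyA) hx hy hxl hyl,
    ← hY.holonomy_mono hφ hl hB (span_pair_le hxB hyB) hx hy hxl hyl]

variable [Finite K] (hodd : Odd (Nat.card K)) (hs : f.IsSymm)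

include hodd hs

/-- The vectors `x` and `y` are joined by elliptic lines to vectors `z` and `z'` of the shared
elliptic line `⟨m, n⟩`. Each leg of the path `x, z, z', y` has the same holonomy in both members. -/
theorem holonomy_eq_of_line {A B : Submodule K V} (hA : A ∈ Y) (hB : B ∈ Y) {x y m n : V}
    (hx : f x x ≠ 0) (hy : f y y ≠ 0)
    (hmn : f m n = 0) (hsq : ¬ IsSquare (-(f m m * f n n)))
    (hxA : x ∈ A) (hyA : y ∈ A) (hmA : m ∈ A) (hnA : n ∈ A)
    (hxB : x ∈ B) (hyB : y ∈ B) (hmB : m ∈ B) (hnB : n ∈ B) :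
    holonomy φ A x y = holonomy φ B x y := by
  have hnm : f n m = 0 := (hs.eq _ _).trans hmn
  have hl := hY.line m n (by rw [hmn]; convert hsq using 2; ring)
  have near : ∀ x, f x x ≠ 0 → ∃ z ∈ Submodule.span K {m, n},
      ¬ IsSquare (f z x ^ 2 - f z z * f x x) := by
    intro x hx
    obtain ⟨s, t, hst⟩ := exists_not_isSquare_discriminant hodd (b := f m x) (c := f n x) hx hsq
    refine ⟨s • m + t • n, Submodule.mem_span_pair.2 ⟨s, t, rfl⟩, ?_⟩
    convert hst using 2
    simp only [map_add, LinearMap.add_apply, map_smul, LinearMap.smul_apply, smul_eq_mul, hmn, hnm]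
    ring
  obtain ⟨z, hzl, hz⟩ := near x hx
  obtain ⟨z', hzl', hz'⟩ := near y hy
  have hzz : f z z ≠ 0 := fun h => hz (by rw [h]; exact ⟨f z x, by ring⟩)
  have hzz' : f z' z' ≠ 0 := fun h => hz' (by rw [h]; exact ⟨f z' y, by ring⟩)
  have hlA := span_pair_le hmA hnA
  have hlB := span_pair_le hmB hnB
  rw [hs.eq z x, mul_comm (f z z)] at hz
  rw [← holonomy_mul A x z y, ← holonomy_mul A z z' y, ← holonomy_mul B x z y,
    ← holonomy_mul B z z' y,
    hY.holonomy_eq_of_not_isSquare hφ hA hB hz hxA (hlA hzl) hxB (hlB hzl),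
    hY.holonomy_eq_of_not_isSquare hφ hA hB hz' (hlA hzl') hyA (hlB hzl') hyB,
    ← hY.holonomy_mono hφ hl hA hlA hzz hzz' hzl hzl',
    ← hY.holonomy_mono hφ hl hB hlB hzz hzz' hzl hzl']

/-- The shared plane contains an elliptic line: `u` together with a vector of `⟨x, y⟩` of norm `-n /
f u u`, where `n` is a nonsquare. -/
theorem holonomy_eq_of_plane {A B : Submodule K V} (hA : A ∈ Y) (hB : B ∈ Y) {x y u : V}
    (hx : f x x ≠ 0) (hy : f y y ≠ 0) (hxy : gram f x y ≠ 0)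
    (hux : f u x = 0) (huy : f u y = 0) (hu : f u u ≠ 0)
    (hxA : x ∈ A) (hyA : y ∈ A) (huA : u ∈ A)
    (hxB : x ∈ B) (hyB : y ∈ B) (huB : u ∈ B) :
    holonomy φ A x y = holonomy φ B x y := by
  obtain ⟨n, hn⟩ := exists_not_isSquare (K := K) hodd
  obtain ⟨a, b, hab⟩ := exists_smul_add_smul_eq hodd hs hx hxy (-n / f u u)
  refine hY.holonomy_eq_of_line hφ hodd hs hA hB (m := u) (n := a • x + b • y) hx hy
    (by simp [hux, huy]) ?_ hxA hyA huA
    (A.add_mem (A.smul_mem a hxA) (A.smul_mem b hyA)) hxB hyB huB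
    (B.add_mem (B.smul_mem a hxB) (B.smul_mem b hyB))
  rw [hab]
  convert hn using 2
  field_simp

variable [FiniteDimensional K V] (hf : f.Nondegenerate) (hdim : 5 ≤ Module.finrank K V)

include hf hdim

theorem holonomy_eq (hcard : 6 ≤ Nat.card K) {A B : Submodule K V} (hA : A ∈ Y) (hB : B ∈ Y)
    {x y : V} (hx : f x x ≠ 0) (hy : f y y ≠ 0) (hxy : gram f x y ≠ 0)
    (hxA : x ∈ A) (hyA : y ∈ A) (hxB : x ∈ B) (hyB : y ∈ B) :
    holonomy φ A x y = holonomy φ B x y := by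
  have h2 := two_ne_zero_of_odd_card hodd
  obtain ⟨M, hM, hxM, hyM, ⟨u₀, ux₀, uy₀, hu₀⟩, hub⟩ :=
    hY.exists_hub hodd hcard hs hf hdim hx hxy
  suffices ∀ A ∈ Y, x ∈ A → y ∈ A → holonomy φ A x y = holonomy φ M x y by
    rw [this A hA hxA hyA, this B hB hxB hyB]
  intro A hA hxA hyA
  have toM : ∀ u, f u x = 0 → f u y = 0 → f u u ≠ 0 → ∃ E ∈ Y, x ∈ E ∧ y ∈ E ∧ u ∈ E ∧
      holonomy φ E x y = holonomy φ M x y := by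
    intro u ux uy hu
    obtain ⟨z, hzM, zx, zy, hz, hg, hsq⟩ := hub u ux uy hu
    have hxE : x ∈ Submodule.span K {x, y, u, z} := Submodule.subset_span (by simp)
    have hyE : y ∈ Submodule.span K {x, y, u, z} := Submodule.subset_span (by simp)
    have hE := hY.four x y u z hx hu hxy hg ux uy zx zy hsq
    exact ⟨_, hE, hxE, hyE, Submodule.subset_span (by simp),
      hY.holonomy_eq_of_plane hφ hodd hs hE hM hx hy hxy zx zy hz hxE hyE
        (Submodule.subset_span (by simp)) hxM hyM hzM⟩
  -- Either `A` is contained in the line and so in some four-space `E` comparable with the hub, or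
  -- it contains some `u` orthogonal to the line and shares the plane `⟨x, y, u⟩` with such an `E`.
  by_cases hle : A ≤ Submodule.span K {x, y}
  · obtain ⟨E, hE, hxE, hyE, -, e⟩ := toM u₀ ux₀ uy₀ hu₀
    rw [← e]
    exact hY.holonomy_mono hφ hA hE (hle.trans (span_pair_le hxE hyE)) hx hy hxA hyA
  · obtain ⟨v, hv, hvs, -⟩ := exists_orthFamily_pair hs hx hxy
    obtain ⟨u, huA, huS, hu⟩ := exists_orth_anisotropic h2 hs (hY.nondeg A hA)
      (hvs ▸ hv.isNondegOn_spanLT) (span_pair_le hxA hyA) hle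
    have ux := huS x (Submodule.subset_span (by simp))
    have uy := huS y (Submodule.subset_span (by simp))
    obtain ⟨E, hE, hxE, hyE, huE, e⟩ := toM u ux uy hu
    rw [← e]
    exact hY.holonomy_eq_of_plane hφ hodd hs hA hE hx hy hxy ux uy hu hxA hyA huA hxE hyE huE

/-- The holonomy between two vectors spanning a nondegenerate line does not depend on the subspace
through which it is computed, and is additive along triangles. -/
theorem exists_connection (hcard : 6 ≤ Nat.card K) :
    ∃ C : V → V → H,
      (∀ A ∈ Y, ∀ x ∈ A, ∀ y ∈ A, f x x ≠ 0 → f y y ≠ 0 → gram f x y ≠ 0 →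
        holonomy φ A x y = C x y) ∧
      ∀ x y z, f x x ≠ 0 → f y y ≠ 0 → f z z ≠ 0 → gram f x y ≠ 0 → gram f y z ≠ 0 →
        gram f x z ≠ 0 → C x y * C y z = C x z := by
  classical
  have h2 := two_ne_zero_of_odd_card hodd
  -- By `holonomy_eq` any member through `x` and `y` gives the same value on pairs that matter; the
  -- value `1` elsewhere is a dummy.
  let C : V → V → H := fun x y =>
    if h : ∃ A ∈ Y, x ∈ A ∧ y ∈ A then holonomy φ h.choose x y else 1
  have hC : ∀ A ∈ Y, ∀ x ∈ A, ∀ y ∈ A, f x x ≠ 0 → f y y ≠ 0 → gram f x y ≠ 0 →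
      holonomy φ A x y = C x y := by
    intro A hA x hxA y hyA hx hy hxy
    have h : ∃ A ∈ Y, x ∈ A ∧ y ∈ A := ⟨A, hA, hxA, hyA⟩
    simp only [C, dif_pos h]
    exact hY.holonomy_eq hφ hodd hs hf hdim hcard hA h.choose_spec.1 hx hy hxy hxA hyA
      h.choose_spec.2.1 h.choose_spec.2.2
  have hE : ∀ E ∈ Y, ∀ x ∈ E, ∀ y ∈ E, ∀ z ∈ E, f x x ≠ 0 → f y y ≠ 0 → f z z ≠ 0 →
      gram f x y ≠ 0 → gram f y z ≠ 0 → gram f x z ≠ 0 → C x y * C y z = C x z := by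
    intro E hE x hxE y hyE z hzE hx hy hz hxy hyz hxz
    rw [← hC E hE x hxE y hyE hx hy hxy, ← hC E hE y hyE z hzE hy hz hyz,
      ← hC E hE x hxE z hzE hx hz hxz, holonomy_mul]
  have inv : ∀ x y, f x x ≠ 0 → f y y ≠ 0 → gram f x y ≠ 0 → C x y * C y x = 1 := by
    intro x y hx hy hxy
    obtain ⟨M, hM, hxM, hyM, -⟩ := hY.exists_hub hodd hcard hs hf hdim hx hxy
    rw [← hC M hM x hxM y hyM hx hy hxy,
      ← hC M hM y hyM x hxM hy hx (gram_comm hs x y ▸ hxy), holonomy_mul, holonomy, mul_inv_cancel]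
  -- The last hypothesis is that the Gram determinant of `x, y, z` is nonzero. The component of `z`
  -- orthogonal to `⟨x, y⟩` is then anisotropic, and a member contains all three vectors.
  have hnd : ∀ x y z, f x x ≠ 0 → f y y ≠ 0 → f z z ≠ 0 → gram f x y ≠ 0 → gram f y z ≠ 0 →
      gram f x z ≠ 0 → f x x * f y y * f z z + 2 * f y z * f x z * f x y - f x x * f y z ^ 2 -
        f y y * f x z ^ 2 - f z z * f x y ^ 2 ≠ 0 → C x y * C y z = C x z := by
    intro x y z hx hy hz hxy hyz hxz h3
    obtain ⟨a, b, px, py, hp⟩ := exists_orth_proj hs hxy z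
    rw [← hp] at h3
    obtain ⟨E, hEY, hxE, hyE, hpE⟩ := hY.exists_mem_three hodd hcard hs hf hdim hx hxy px py
      (left_ne_zero_of_mul h3)
    refine hE E hEY x hxE y hyE z ?_ hx hy hz hxy hyz hxz
    have : z = (z - a • x - b • y) + b • y + a • x := by abel
    rw [this]
    exact E.add_mem (E.add_mem hpE (E.smul_mem b hyE)) (E.smul_mem a hxE)
  refine ⟨C, hC, fun x y z hx hy hz hxy hyz hxz => ?_⟩
  obtain ⟨a, b, px, py, hp⟩ := exists_orth_proj hs hxy z
  obtain ⟨r, hr⟩ : ∃ r, r = z - a • x - b • y := ⟨_, rfl⟩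
  rw [← hr] at px py hp
  have hzr : z = r + b • y + a • x := by rw [hr]; abel
  by_cases hr0 : r = 0
  · obtain ⟨M, hM, hxM, hyM, -⟩ := hY.exists_hub hodd hcard hs hf hdim hx hxy
    refine hE M hM x hxM y hyM z ?_ hx hy hz hxy hyz hxz
    rw [hzr, hr0, zero_add]
    exact M.add_mem (M.smul_mem b hyM) (M.smul_mem a hxM)
  by_cases hrr : f r r = 0
  swap
  · exact hnd x y z hx hy hz hxy hyz hxz (by rw [← hp]; exact mul_ne_zero hrr hxy)
  obtain ⟨v, hv⟩ : ∃ v, f r v ≠ 0 := by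
    by_contra! h
    exact hr0 (hf.1 r h)
  obtain ⟨c, d, vx, vy, -⟩ := exists_orth_proj hs hxy v
  obtain ⟨v', hv'⟩ : ∃ v', v' = v - c • x - d • y := ⟨_, rfl⟩
  rw [← hv'] at vx vy
  have hrv' : f r v' ≠ 0 := by rw [hv']; simpa [px, py] using hv
  have hv'r := hs.eq v' r
  set h := f r v' with hh
  -- In the degenerate case `r` is isotropic. The new apex `w` is orthogonal to `x` and `y`, has
  -- inner product `h` with `r`, and has norm `s`. The excluded values of `s` are those for which
  -- `w`, the line `⟨z, w⟩`, or one of the spaces `⟨x, w, z⟩`, `⟨y, w, z⟩` is degenerate.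
  obtain ⟨s, hs1⟩ : ∃ s : K, s ∉ ({0, h ^ 2 / f z z, h ^ 2 * f x x / gram f x z,
      h ^ 2 * f y y / gram f y z} : Finset K) := by
    by_contra! hall
    have : Fintype K := Fintype.ofFinite K
    have h1 := Finset.card_le_card (fun t _ => hall t : (Finset.univ : Finset K) ⊆ _)
    rw [Finset.card_univ, ← Nat.card_eq_fintype_card] at h1
    have := h1.trans Finset.card_le_four
    omega
  simp only [Finset.mem_insert, Finset.mem_singleton, not_or] at hs1
  obtain ⟨s0, sz, sxz, syz⟩ := hs1
  obtain ⟨w, hw⟩ : ∃ w, w = ((s - f v' v') / (2 * h)) • r + v' := ⟨_, rfl⟩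
  have hww : f w w = s := by
    rw [hw]; simp only [map_add, LinearMap.add_apply, map_smul, LinearMap.smul_apply,
      smul_eq_mul, hrr, hv'r, ← hh]
    field_simp; ring
  have wx : f w x = 0 := by rw [hw]; simp [px, vx]
  have wy : f w y = 0 := by rw [hw]; simp [py, vy]
  have wr : f w r = h := by rw [hw]; simp [hrr, hv'r, hh]
  have wz : f w z = h := by rw [hzr]; simp [wx, wy, wr]
  have xw : f x w = 0 := (hs.eq _ _).trans wx
  have yw : f y w = 0 := (hs.eq _ _).trans wy
  have zw : f z w = h := (hs.eq _ _).trans wz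
  have zx := hs.eq z x
  have zy := hs.eq z y
  have hw0 : f w w ≠ 0 := by rwa [hww]
  have gxw : gram f x w ≠ 0 := by simp [gram, xw, hw0, hx]
  have gyw : gram f y w ≠ 0 := by simp [gram, yw, hw0, hy]
  have gzw : gram f z w ≠ 0 := by
    rw [gram, zw, hww]
    intro h0
    exact sz (by field_simp; linear_combination h0)
  have gwy := gram_comm hs y w ▸ gyw
  have gwz := gram_comm hs z w ▸ gzw
  obtain ⟨E, hEY, hxE, hyE, hwE⟩ := hY.exists_mem_three hodd hcard hs hf hdim hx hxy wx wy hw0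
  have t1 := hE E hEY x hxE w hwE y hyE hx hw0 hy gxw gwy hxy
  have t2 := hnd y w z hy hw0 hz gyw gwz hyz (by
    rw [yw, wz, hww]
    intro h0
    exact syz (by rw [eq_div_iff hyz, gram]; linear_combination h0))
  have t3 := hnd x w z hx hw0 hz gxw gwz hxz (by
    rw [xw, wz, hww]
    intro h0
    exact sxz (by rw [eq_div_iff hxz, gram]; linear_combination h0))
  rw [← t1, ← t2, ← t3, mul_assoc, ← mul_assoc (C w y), inv w y hw0 hy gwy, one_mul]

/-- A cocycle on a rich family of subspaces is a coboundary. -/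
theorem exists_coboundary (hcard : 9 ≤ Nat.card K) :
    ∃ ψ : Submodule K V → H, ∀ A ∈ Y, ∀ B ∈ Y, A ≤ B → φ A B = (ψ A)⁻¹ * ψ B := by
  classical
  have h2 := two_ne_zero_of_odd_card hodd
  have hcard' : 6 ≤ Nat.card K := by omega
  obtain ⟨C, hC, hT⟩ := hY.exists_connection hφ hodd hs hf hdim hcard'
  have inv : ∀ x y, f x x ≠ 0 → f y y ≠ 0 → gram f x y ≠ 0 → C x y * C y x = 1 := by
    intro x y hx hy hxy
    obtain ⟨M, hM, hxM, hyM, -⟩ := hY.exists_hub hodd hcard' hs hf hdim hx hxy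
    rw [← hC M hM x hxM y hyM hx hy hxy,
      ← hC M hM y hyM x hxM hy hx (gram_comm hs x y ▸ hxy), holonomy_mul, holonomy, mul_inv_cancel]
  obtain ⟨o, -, -, -, ho, -⟩ := exists_orth_pair h2 hs hf (isOrthFamily_zero fun _ => 0)
    (by omega)
  have nbr : ∀ x, ∃ m, f x x ≠ 0 → f m m ≠ 0 ∧ gram f o m ≠ 0 ∧ gram f m x ≠ 0 := by
    intro x
    by_cases hx : f x x = 0
    · exact ⟨0, fun h => absurd hx h⟩
    · obtain ⟨w, hw, hwo, hwx, -⟩ := exists_common_neighbour hodd hcard hs hf hdim ho hx ho ho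
      exact ⟨w, fun _ => ⟨hw, gram_comm hs w o ▸ hwo, hwx⟩⟩
  choose m hm using nbr
  -- The potential is the connection along a path of length two from the base vector `o`.
  let ψ : V → H := fun x => C o (m x) * C (m x) x
  have hψ : ∀ x n, f x x ≠ 0 → f n n ≠ 0 → gram f o n ≠ 0 → gram f n x ≠ 0 →
      ψ x = C o n * C n x := by
    intro x n hx hn hon hnx
    obtain ⟨hmm, hom, hmx⟩ := hm x hx
    -- A common neighbour of `o`, `x` and both midpoints divides the closed path into four
    -- triangles.
    obtain ⟨w, hw, hwo, hwx, hwm, hwn⟩ :=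
      exists_common_neighbour hodd hcard hs hf hdim ho hx hmm hn
    have how := gram_comm hs w o ▸ hwo
    have via : ∀ n, f n n ≠ 0 → gram f o n ≠ 0 → gram f n x ≠ 0 → gram f w n ≠ 0 →
        C o n * C n x = C o w * C w x := by
      intro n hn hon hnx hwn
      rw [← hT o w n ho hw hn how hwn hon, ← hT n w x hn hw hx (gram_comm hs w n ▸ hwn) hwx hnx,
        mul_assoc, ← mul_assoc (C w n), inv w n hw hn hwn, one_mul]
    rw [via n hn hon hnx hwn]
    exact via (m x) hmm hom hmx hwm
  have hψC : ∀ x y, f x x ≠ 0 → f y y ≠ 0 → gram f x y ≠ 0 → ψ x * C x y = ψ y := by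
    intro x y hx hy hxy
    obtain ⟨w, hw, hwo, hwx, hwy, -⟩ := exists_common_neighbour hodd hcard hs hf hdim ho hx hy hy
    have how := gram_comm hs w o ▸ hwo
    rw [hψ x w hx hw how hwx, hψ y w hy hw how hwy, mul_assoc, hT w x y hw hx hy hwx hxy hwy]
  have base : ∀ A, ∃ v, A ∈ Y → v ∈ A ∧ f v v ≠ 0 := by
    intro A
    by_cases hA : A ∈ Y
    · obtain ⟨u, huA, -, hu⟩ := exists_orth_anisotropic h2 hs (hY.nondeg A hA)
        (S := ⊥) (fun x hx _ => by simpa using hx) bot_le (by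
          simpa using hY.ne_bot A hA)
      exact ⟨u, fun _ => ⟨huA, hu⟩⟩
    · exact ⟨0, fun h => absurd h hA⟩
  choose b hb using base
  have adj : ∀ A ∈ Y, ∀ v ∈ A, ∀ w ∈ A, f v v ≠ 0 → f w w ≠ 0 → gram f v w ≠ 0 →
      ψ v * φ (Submodule.span K {v}) A = ψ w * φ (Submodule.span K {w}) A := by
    intro A hA v hvA w hwA hv hw hvw
    rw [← hψC v w hv hw hvw, ← hC A hA v hvA w hwA hv hw hvw, holonomy]
    group
  have indep : ∀ A ∈ Y, ∀ v ∈ A, ∀ w ∈ A, f v v ≠ 0 → f w w ≠ 0 →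
      ψ v * φ (Submodule.span K {v}) A = ψ w * φ (Submodule.span K {w}) A := by
    intro A hA v hvA w hwA hv hw
    -- Proportional vectors span no line, but they give the same point, so a third vector sees the
    -- same holonomy to both. Otherwise `A` contains an intermediate vector adjacent to `v` and to
    -- `w`.
    by_cases hwv : w ∈ Submodule.span K {v}
    · have hsp : Submodule.span K {w} = Submodule.span K {v} := by
        obtain ⟨c, rfl⟩ := Submodule.mem_span_singleton.1 hwv
        have hc : c ≠ 0 := by rintro rfl; simp at hw
        exact Submodule.span_singleton_smul_eq (IsUnit.mk0 c hc) v
      obtain ⟨z, hz, hzv, hzw, -⟩ := exists_common_neighbour hodd hcard hs hf hdim hv hw hv hv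
      obtain ⟨M, hM, hzM, hvM, -⟩ := hY.exists_hub hodd hcard' hs hf hdim hz hzv
      have hwM : w ∈ M := span_singleton_le' hvM hwv
      have : C z v = C z w := by
        rw [← hC M hM z hzM v hvM hz hv hzv, ← hC M hM z hzM w hwM hz hw hzw, holonomy, holonomy,
          hsp]
      rw [← hψC z v hz hv hzv, ← hψC z w hz hw hzw, this, hsp]
    · have hne : ¬ A ≤ Submodule.span K {v} := fun h => hwv (h hwA)
      have hnd : IsNondegOn f (Submodule.span K {v}) := by
        have := (isOrthFamily_singleton hv).isNondegOn_spanLT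
        rwa [spanLT_const_one] at this
      obtain ⟨u, huA, huv, hu⟩ := exists_orth_anisotropic h2 hs (hY.nondeg A hA) hnd
        (span_singleton_le' hvA) hne
      have huv' : f u v = 0 := huv v (Submodule.mem_span_singleton_self v)
      obtain ⟨z, hzA, hz⟩ := exists_forall_ne_zero A
        [fun z => f z z, fun z => gram f z v, fun z => gram f z w] (by
          simp only [List.forall_mem_cons]
          exact ⟨isQuadratic_self, isQuadratic_gram v, isQuadratic_gram w, by simp⟩) (by
          simp only [List.forall_mem_cons]
          exact ⟨⟨v, hvA, hv⟩, exists_gram_ne_zero h2 hs huA hvA hu hv huv' hv,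
            exists_gram_ne_zero h2 hs huA hvA hu hv huv' hw, by simp⟩) (by simp; omega)
      simp only [List.forall_mem_cons] at hz
      rw [← adj A hA z hzA v hvA hz.1 hv hz.2.1, ← adj A hA z hzA w hwA hz.1 hw hz.2.2.1]
  refine ⟨fun A => ψ (b A) * φ (Submodule.span K {b A}) A, fun A hA B hB hAB => ?_⟩
  obtain ⟨hbA, hbA'⟩ := hb A hA
  obtain ⟨hbB, hbB'⟩ := hb B hB
  beta_reduce
  rw [← indep B hB (b A) (hAB hbA) (b B) hbB hbA' hbB',
    ← hφ _ (hY.point _ hbA') A hA B hB (span_singleton_le' hbA) hAB]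
  group

end IsRich

end Cocycle

end OrthGeom

/-! ### Richness of the orbit, connectedness and conclusion -/

namespace OrthGeom

section Main

variable {K : Type*} [Field K] [Finite K] {V : Type*} [AddCommGroup V] [Module K V]
  [FiniteDimensional K V] {f : LinearMap.BilinForm K V}

theorem spanLT_mem_orbitSet (hodd : Odd (Nat.card K)) (hs : f.IsSymm) (hf : f.Nondegenerate)
    {W : Set (NondegSubspace f)} {w : NondegSubspace f} (hw : w ∈ W) {v : ℕ → V} {k : ℕ}
    (hv : IsOrthFamily f v k) (hk : w.dim = k)
    (hpos : IsPositiveForm (f.restrict (spanLT K v k)) ↔ w.IsPositive) :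
    ∃ x ∈ orbitSet f W, x.1 = spanLT K v k := by
  have h2 := two_ne_zero_of_odd_card hodd
  have hfr := hv.finrank_spanLT
  have hk' : Module.finrank K w.1 = k := hk
  have hk0 : 0 < k := by
    rw [← hk', Module.finrank_pos_iff]
    exact Submodule.nontrivial_iff_ne_bot.2 w.2.1
  have hkN : k < Module.finrank K V := hk' ▸ Submodule.finrank_lt w.2.2.1
  let x : NondegSubspace f := ⟨spanLT K v k, by
    intro h; rw [h, finrank_bot] at hfr; omega, by
    intro h; rw [h, finrank_top] at hfr; omega, (isNondegOn_iff hs _).1 hv.isNondegOn_spanLT⟩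
  refine ⟨x, mem_orbitSet hodd hs hf hw (hfr.trans hk'.symm) ?_, rfl⟩
  exact isSquare_discr_mul_of_isPositiveForm_iff hodd (hfr.trans hk'.symm) hv.discr_ne_zero
    (discr_restrict_ne_zero h2 hs (w.isNondegOn hs)) hpos

/-- Every anisotropic point has the sign of `p` or of `p'`. A line is negative when minus its Gram
determinant is a nonsquare, and a four-space is positive when its Gram determinant is a square, so
the conditions in `IsRich` match the signs of `l` and `U`. -/
theorem isRich_orbitSet (hodd : Odd (Nat.card K)) (hs : f.IsSymm) (hf : f.Nondegenerate)
    {W : Set (NondegSubspace f)} {p p' l U : NondegSubspace f}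
    (hpW : p ∈ W) (hpW' : p' ∈ W) (hlW : l ∈ W) (hUW : U ∈ W)
    (hp : p.dim = 1 ∧ p.IsPositive) (hp' : p'.dim = 1 ∧ p'.IsNegative)
    (hl : l.dim = 2 ∧ l.IsNegative) (hU : U.dim = 4 ∧ U.IsPositive) :
    IsRich f {A | ∃ x ∈ orbitSet f W, x.1 = A} where
  nondeg := by rintro _ ⟨x, -, rfl⟩; exact x.isNondegOn hs
  ne_bot := by rintro _ ⟨x, -, rfl⟩; exact x.2.1
  point x hx := by
    rw [← spanLT_const_one]
    by_cases h : IsPositiveForm (f.restrict (spanLT K (fun _ : ℕ => x) 1))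
    · exact spanLT_mem_orbitSet hodd hs hf hpW (isOrthFamily_singleton hx) hp.1
        (iff_of_true h hp.2)
    · exact spanLT_mem_orbitSet hodd hs hf hpW' (isOrthFamily_singleton hx) hp'.1
        (iff_of_false h hp'.2)
  line x y hxy := by
    have hx : f x x ≠ 0 := fun h => hxy (by rw [h]; exact ⟨f x y, by ring⟩)
    have hg : f x y ^ 2 - f x x * f y y = -gram f x y := by rw [gram]; ring
    rw [hg] at hxy
    have hg0 : gram f x y ≠ 0 := fun h => hxy (by simp [h])
    obtain ⟨v, hv, hvs, hvp⟩ := exists_orthFamily_pair hs hx hg0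
    rw [← hvs]
    refine spanLT_mem_orbitSet hodd hs hf hlW hv hl.1 (iff_of_false ?_ hl.2)
    obtain ⟨s, hs0, hd⟩ := hv.discr_spanLT
    rw [Finset.prod_range_succ, Finset.prod_range_one, hvp] at hd
    intro hpos
    rcases hpos with ⟨-, h⟩ | ⟨⟨-, h⟩, -⟩
    · rw [hv.finrank_spanLT, hd] at h
      apply hxy
      rw [← isSquare_mul_sq_iff hs0]
      convert h using 1
      norm_num
    · rw [hv.finrank_spanLT] at h
      exact absurd h (by decide)
  four x y u z hx hu hxy huz hux huy hzx hzy hsq := by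
    obtain ⟨v, hv, hvs, hvp⟩ := exists_orthFamily_four hs hx hu hxy huz hux huy hzx hzy
    rw [← hvs]
    refine spanLT_mem_orbitSet hodd hs hf hUW hv hU.1 (iff_of_true ?_ hU.2)
    obtain ⟨s, hs0, hd⟩ := hv.discr_spanLT
    rw [hvp] at hd
    refine Or.inl ⟨Or.inr (by rw [hv.finrank_spanLT]; decide), ?_⟩
    rw [hv.finrank_spanLT, hd]
    simpa [isSquare_mul_sq_iff hs0] using hsq

theorem IsRich.exists_anisotropic_mem {Y : Set (Submodule K V)} (hY : IsRich f Y)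
    (hodd : Odd (Nat.card K)) (hs : f.IsSymm) {A : Submodule K V} (hA : A ∈ Y) :
    ∃ v ∈ A, f v v ≠ 0 := by
  obtain ⟨u, huA, -, hu⟩ := exists_orth_anisotropic (two_ne_zero_of_odd_card hodd) hs
    (hY.nondeg A hA) (S := ⊥) (fun x hx _ => by simpa using hx) bot_le
    (by simpa using hY.ne_bot A hA)
  exact ⟨u, huA, hu⟩

/-- Points in the two given elements have a common neighbour, and each of the two nondegenerate
lines so obtained lies in a hub. -/
theorem isConnected_orthPregeometryOf (hodd : Odd (Nat.card K)) (hcard : 9 ≤ Nat.card K)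
    (hs : f.IsSymm) (hf : f.Nondegenerate) (hdim : 5 ≤ Module.finrank K V)
    {W : Set (NondegSubspace f)} (hY : IsRich f {A | ∃ x ∈ orbitSet f W, x.1 = A}) :
    (orthPregeometryOf f W).IsConnected := by
  have hcard' : 6 ≤ Nat.card K := by omega
  have lift : ∀ A ∈ {A | ∃ x ∈ orbitSet f W, x.1 = A}, ∃ x : orbitSet f W, x.1.1 = A := by
    rintro A ⟨x, hx, e⟩
    exact ⟨⟨x, hx⟩, e⟩
  constructor
  · obtain ⟨o, -, -, -, ho, -⟩ := exists_orth_pair (two_ne_zero_of_odd_card hodd) hs hf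
      (isOrthFamily_zero fun _ => 0) (by omega)
    exact ⟨(lift _ (hY.point o ho)).choose⟩
  · intro x y
    obtain ⟨v, hvx, hv⟩ := hY.exists_anisotropic_mem hodd hs ⟨x.1, x.2, rfl⟩
    obtain ⟨w, hwy, hw⟩ := hY.exists_anisotropic_mem hodd hs ⟨y.1, y.2, rfl⟩
    obtain ⟨z, hz, hzv, hzw, -⟩ := exists_common_neighbour hodd hcard hs hf hdim hv hw hv hv
    obtain ⟨M, hM, hzM, hvM, -⟩ := hY.exists_hub hodd hcard' hs hf hdim hz hzv
    obtain ⟨N, hN, hzN, hwN, -⟩ := hY.exists_hub hodd hcard' hs hf hdim hz hzw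
    obtain ⟨v', ev⟩ := lift _ (hY.point v hv)
    obtain ⟨w', ew⟩ := lift _ (hY.point w hw)
    obtain ⟨z', ez⟩ := lift _ (hY.point z hz)
    obtain ⟨M', eM⟩ := lift _ hM
    obtain ⟨N', eN⟩ := lift _ hN
    have le : ∀ a b : orbitSet f W, a.1.1 ≤ b.1.1 → (orthPregeometryOf f W).inc a b :=
      fun a b h => Or.inl h
    have ge : ∀ a b : orbitSet f W, b.1.1 ≤ a.1.1 → (orthPregeometryOf f W).inc a b :=
      fun a b h => Or.inr h
    refine .head (ge x v' ?_) <| .head (le v' M' ?_) <| .head (ge M' z' ?_) <|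
      .head (le z' N' ?_) <| .head (ge N' w' ?_) <| .single (le w' y ?_)
    · rw [ev]; exact span_singleton_le' hvx
    · rw [ev, eM]; exact span_singleton_le' hvM
    · rw [ez, eM]; exact span_singleton_le' hzM
    · rw [ez, eN]; exact span_singleton_le' hzN
    · rw [ew, eN]; exact span_singleton_le' hwN
    · rw [ew]; exact span_singleton_le' hwy

theorem isSimplyConnectedGeometry_orthPregeometryOf (hodd : Odd (Nat.card K))
    (hcard : 9 ≤ Nat.card K) (hs : f.IsSymm) (hf : f.Nondegenerate)
    (hdim : 5 ≤ Module.finrank K V) {W : Set (NondegSubspace f)}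
    (hY : IsRich f {A | ∃ x ∈ orbitSet f W, x.1 = A}) :
    (orthPregeometryOf f W).IsSimplyConnectedGeometry := by
  have hconn := isConnected_orthPregeometryOf hodd hcard hs hf hdim hY
  refine ⟨isGeometry_orthPregeometryOf hodd hs hf W, hconn,
    Pregeometry.trivialFundamentalGroupAt_of_cocycle hconn fun H _ φ hφ => ?_⟩
  obtain ⟨x₀⟩ := hconn.1
  -- The cocycle is transported to all subspaces of `V`, with the arbitrary element `x₀` as value
  -- outside the family.
  have lift : ∀ A : Submodule K V, ∃ x : orbitSet f W,
      A ∈ {A | ∃ x ∈ orbitSet f W, x.1 = A} → x.1.1 = A := by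
    intro A
    by_cases h : A ∈ {A | ∃ x ∈ orbitSet f W, x.1 = A}
    · obtain ⟨x, hx, e⟩ := h
      exact ⟨⟨x, hx⟩, fun _ => e⟩
    · exact ⟨x₀, fun h' => absurd h' h⟩
  choose e he using lift
  have he' : ∀ x : orbitSet f W, e x.1.1 = x := fun x =>
    Subtype.ext (Subtype.ext (he _ ⟨x.1, x.2, rfl⟩))
  obtain ⟨ψ, hψ⟩ := hY.exists_coboundary (φ := fun A B => φ (e A) (e B)) (by
    intro A hA B hB C hC hAB hBC
    refine hφ _ _ _ (Or.inl ?_) (Or.inl ?_) (Or.inl ?_)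
    · show (e A).1.1 ≤ (e B).1.1
      rwa [he A hA, he B hB]
    · show (e B).1.1 ≤ (e C).1.1
      rwa [he B hB, he C hC]
    · show (e A).1.1 ≤ (e C).1.1
      rw [he A hA, he C hC]
      exact hAB.trans hBC) hodd hs hf hdim hcard
  have key : ∀ x y : orbitSet f W, x.1.1 ≤ y.1.1 → φ x y = (ψ x.1.1)⁻¹ * ψ y.1.1 := by
    intro x y hxy
    have := hψ _ ⟨x.1, x.2, rfl⟩ _ ⟨y.1, y.2, rfl⟩ hxy
    simpa only [he'] using this
  refine ⟨fun x => ψ x.1.1, fun x y hxy => ?_⟩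
  rcases hxy with h | h
  · exact key x y h
  -- Only nested pairs in increasing order are covered by `key`. For the opposite order, the
  -- degenerate triangle `x, y, x` shows that `φ x y` is inverse to `φ y x`.
  · have h1 := hφ x y x (Or.inr h) (Or.inl h) (Or.inl le_rfl)
    rw [key x x le_rfl, inv_mul_cancel, key y x h] at h1
    rw [eq_inv_of_mul_eq_one_left h1]
    group

end Main

end OrthGeom

theorem mainTheorem6 {K : Type*} [Field K] [Finite K]
    (hq_odd : Odd (Nat.card K)) (hq : 9 ≤ Nat.card K)
    {V : Type*} [AddCommGroup V] [Module K V] [FiniteDimensional K V]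
    (hdim : 5 ≤ Module.finrank K V)
    (f : LinearMap.BilinForm K V) (hf_symm : f.IsSymm) (hf_nondeg : f.Nondegenerate)
    (hf_neg : OrthGeom.IsNegativeForm f)
    (p p' l π U : OrthGeom.NondegSubspace f)
    (hp : p.dim = 1 ∧ p.IsPositive)
    (hp' : p'.dim = 1 ∧ p'.IsNegative)
    (hl : l.dim = 2 ∧ l.IsNegative)
    (hπ : π.dim = 3)
    (hU : U.dim = 4 ∧ U.IsPositive)
    {t : ℕ} (Us : Fin t → OrthGeom.NondegSubspace f) (hUs : ∀ i, 3 ≤ (Us i).dim)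
    (hW : (OrthGeom.orthPregeometry f).IsLounge ({p, p', l, π, U} ∪ Set.range Us)) :
    (OrthGeom.orthPregeometryOf f
      ({p, p', l, π, U} ∪ Set.range Us)).IsSimplyConnectedGeometry := by
  exact OrthGeom.isSimplyConnectedGeometry_orthPregeometryOf hq_odd hq hf_symm hf_nondeg hdim
    (OrthGeom.isRich_orbitSet hq_odd hf_symm hf_nondeg (by simp) (by simp) (by simp) (by simp)
      hp hp' hl hU)
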